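/- Let $g=g(z)$ be a smooth, strictly positive, strictly monotone (increasing or decreasing) function on $\mathbb{R}$ (for example $g=e^z$). On $\mathbb{R}^4$ with coordinates $(x,y,z,w)$ consider the rank-three distribution $D=\ker\eta$, \[ \eta=\frac{g(z)}{\sqrt2}\Bigl(dw-\frac y2\,dx+\frac x2\,dy\Bigr), \] with the sub-Riemannian metric for which \[ X=\frac1{\sqrt g}\Bigl(\partial_x+\frac y2\partial_w\Bigr),\qquad Y=\frac1{\sqrt g}\Bigl(\partial_y-\frac x2\partial_w\Bigr),\qquad Z=\frac1{\sqrt g}\,\partial_z \] is a global orthonormal frame of $D$. *Definitions.* Popp's volume $\mathcal P$ is the smooth 4-form, unique up to sign, with $\mathcal P(X,Y,Z,W)=\pm1$ whenever the class of $W$ is a unit vector of $T_qM/D_q$, where $T_qM/D_q$ carries the norm induced by the surjection $D_q\otimes D_q\to T_qM/D_q$, $V_1\otimes V_2\mapsto[V_1,V_2]_q \bmod D_q$ (the norm of a class is the least norm of a preimage). The macroscopic Laplacian is $\Delta_{\mathcal P}=\mathrm{div}_{\mathcal P}\circ\mathrm{grad}$, where $\mathrm{grad}$ is the horizontal gradient.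 A complement is a smooth line sub-bundle $V\subset TM$ with $T_qM=D_q\oplus V_q$ for all $q$. Let $H(\lambda)=\frac12(\langle\lambda,X\rangle^2+\langle\lambda,Y\rangle^2+\langle\lambda,Z\rangle^2)$, and let $\exp_q(t,\lambda)$ be the position at time $t$ of the normal geodesic (the projection of the Hamiltonian trajectory of $H$) with initial covector $\lambda\in T_q^*M$. A family of probability measures $\mu_q$ on the cylinders $\{\lambda\in T^*_qM : 2H(\lambda)=1\}$ is adapted to $V$ if, under the identification of the cylinder with $S_q\times D_q^\perp$ by $(u,v)\mapsto u+v$, where $S_q=\{\lambda\in V_q^\perp : 2H(\lambda)=1\}$, each $\mu_q$ is the product of the uniform probability measure on the sphere $S_q$ and a probability measure on $D_q^\perp$ for which all linear functions are square integrable, and if $q\mapsto\int f^2\,d\mu_q$ is continuous for every continuous, fibrewise linear $f:T^*M\to\mathbb{R}$. The microscopic Laplacian is, with $k=3$ the rank of $D$, \[ (L^V\phi)(q)=\lim_{t\to0^+}\frac{2k}{t^2}\int\bigl(\phi(\exp_q(t,\lambda))-\phi(q)\bigr)\,d\mu_q(\lambda),\qquad \phi\in C^\infty(\mathbb{R}^4),\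 q\in\mathbb{R}^4. \] *Statement.* The structure is quasi-contact with minimal degeneration (the dimension is even, and the kernel of $d\eta|_D$ is one-dimensional at every point), and its Popp volume is $\pm\frac{g^{5/2}}{\sqrt2}\,dx\wedge dy\wedge dz\wedge dw$. For every complement $V$, families of measures adapted to $V$ exist, the limit defining $L^V$ exists for each of them and does not depend on the choice of the adapted family, and \[ L^V\neq\Delta_{\mathcal P} \] as operators on $C^\infty(\mathbb{R}^4)$. Thus the macroscopic Laplacian of Popp's volume has no microscopic counterpart. -/

import Mathlib

open MeasureTheory Filter Topology
open scoped ContDiff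

/-- Coordinates on `ℝ^(k+1)`. Tangent vectors at any point, and covectors (paired with tangent
vectors by the dot product `⬝ᵥ`), are written in the coordinate (co)frame and have this type too. -/
abbrev Coord (k : ℕ) : Type := Fin (k + 1) → ℝ

/-- Smooth real functions on `ℝ^(k+1)`. -/
abbrev SmoothFun (k : ℕ) : Type := {φ : Coord k → ℝ // ContDiff ℝ ∞ φ}

/-- A corank one, step two sub-Riemannian structure on `ℝ^(k+1)` with a global orthonormal frame.
The distribution is `ker form`; the scalar product on it is the one for which
`frame 0, …, frame (k-1)` is orthonormal. -/
structure CorankOneStructure (k : ℕ) where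
  form : Coord k → Coord k →L[ℝ] ℝ
  frame : Fin k → Coord k → Coord k
  contDiff_form : ContDiff ℝ ∞ form
  contDiff_frame : ∀ i, ContDiff ℝ ∞ (frame i)
  linearIndependent_frame : ∀ q, LinearIndependent ℝ (fun i => frame i q)
  span_frame : ∀ q, Submodule.span ℝ (Set.range fun i => frame i q)
    = LinearMap.ker (form q : Coord k →ₗ[ℝ] ℝ)
  step_two : ∀ q, ∃ i j, form q (VectorField.lieBracket ℝ (frame i) (frame j) q) ≠ 0

namespace CorankOneStructure

variable {k : ℕ}

/-- The distribution `D = ker η`. -/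
def distribution (S : CorankOneStructure k) (q : Coord k) : Submodule ℝ (Coord k) :=
  LinearMap.ker (S.form q : Coord k →ₗ[ℝ] ℝ)

/-- The exterior derivative of the one-form: `dη(v, w) = (D_v η)(w) - (D_w η)(v)`. -/
noncomputable def dForm (S : CorankOneStructure k) (q : Coord k) :
    Coord k →L[ℝ] Coord k →L[ℝ] ℝ :=
  fderiv ℝ S.form q - (fderiv ℝ S.form q).flip

/-- The kernel of the endomorphism `J` of `D_q` given by `⟨v, J w⟩ = dη(v, w)`, that is, the kernel
of the restriction of `dη` to `D_q`. -/
def kernelJ (S : CorankOneStructure k) (q : Coord k) : Submodule ℝ (Coord k) where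
  carrier := {w | w ∈ S.distribution q ∧ ∀ v ∈ S.distribution q, S.dForm q v w = 0}
  add_mem' := fun ha hb =>
    ⟨add_mem ha.1 hb.1, fun v hv => by rw [map_add, ha.2 v hv, hb.2 v hv, add_zero]⟩
  zero_mem' := ⟨zero_mem _, fun v _ => map_zero _⟩
  smul_mem' := fun c _ ha =>
    ⟨Submodule.smul_mem _ c ha.1, fun v hv => by rw [map_smul, ha.2 v hv, smul_zero]⟩

/-- Quasi-contact with minimal degeneration: the dimension of the manifold is even and `ker J` is
one-dimensional at every point. -/
def IsQuasiContact (S : CorankOneStructure k) : Prop :=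
  Even (k + 1) ∧ ∀ q, Module.finrank ℝ (S.kernelJ q) = 1

/-! ### Volumes and the macroscopic Laplacian -/

/-- `r` is the norm of the class of `w` in `T_q M / D_q`, for the scalar product that the surjection
`D_q ⊗ D_q → T_q M / D_q`, `v₁ ⊗ v₂ ↦ [V₁, V₂]_q mod D_q`, induces on its target: the least norm of
a tensor `∑ a i j • (X_i ⊗ X_j)` that is mapped to the class of `w`. -/
def IsQuotientNorm (S : CorankOneStructure k) (q w : Coord k) (r : ℝ) : Prop :=
  IsLeast {s : ℝ | ∃ a : Fin k → Fin k → ℝ,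
    (∑ i, ∑ j, a i j • VectorField.lieBracket ℝ (S.frame i) (S.frame j) q) - w
        ∈ S.distribution q ∧
      s = √(∑ i, ∑ j, a i j ^ 2)} r

/-- `P` is Popp's volume form (defined up to a sign): on the wedge of an orthonormal basis of
`D_q` and a vector whose class is a unit vector of `T_q M / D_q` it takes the value `± 1`. -/
def IsPoppVolume (S : CorankOneStructure k)
    (P : Coord k → Coord k [⋀^Fin (k + 1)]→L[ℝ] ℝ) : Prop :=
  ContDiff ℝ ∞ P ∧ ∀ q w, S.IsQuotientNorm q w 1 →
    |P q (Fin.snoc (fun i => S.frame i q) w)| = 1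

/-- The horizontal gradient `∑ X_i(φ) X_i`, i.e. the horizontal field with
`⟨grad φ, X_i⟩ = dφ(X_i)` for the orthonormal frame. -/
noncomputable def horizontalGradient (S : CorankOneStructure k) (φ : Coord k → ℝ)
    (q : Coord k) : Coord k :=
  ∑ i, fderiv ℝ φ q (S.frame i q) • S.frame i q

end CorankOneStructure

/-- The Lie derivative of an `n`-form:
`(L_X Ω)(v₁, …) = X(Ω(v₁, …)) - ∑ i, Ω(v₁, …, [X, v_i], …)`, with the tangent vectors `v_i` at `q`
extended to constant vector fields. -/
noncomputable def lieDerivForm {k : ℕ} (X : Coord k → Coord k)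
    (Ω : Coord k → Coord k [⋀^Fin (k + 1)]→L[ℝ] ℝ) (q : Coord k)
    (v : Fin (k + 1) → Coord k) : ℝ :=
  fderiv ℝ (fun p => Ω p v) q (X q)
    - ∑ i, Ω q (Function.update v i (VectorField.lieBracket ℝ X (fun _ => v i) q))

/-- The divergence: `L_X Ω = (div_Ω X) Ω` for a nowhere vanishing top degree form `Ω` (both sides
are compared on the coordinate basis). -/
noncomputable def divergence {k : ℕ} (Ω : Coord k → Coord k [⋀^Fin (k + 1)]→L[ℝ] ℝ)
    (X : Coord k → Coord k) (q : Coord k) : ℝ :=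
  lieDerivForm X Ω q (fun i => Pi.single i 1) / Ω q (fun i => Pi.single i 1)

namespace CorankOneStructure

variable {k : ℕ}

/-- The macroscopic Laplacian `Δ_Ω = div_Ω ∘ grad`. -/
noncomputable def macroLaplacian (S : CorankOneStructure k)
    (Ω : Coord k → Coord k [⋀^Fin (k + 1)]→L[ℝ] ℝ) (φ : SmoothFun k) : Coord k → ℝ :=
  divergence Ω (S.horizontalGradient φ.1)

/-! ### Normal geodesics -/

/-- The sub-Riemannian Hamiltonian `H(q, p) = ½ ∑ ⟨p, X_i⟩²` on the cotangent bundle. -/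
noncomputable def hamiltonian (S : CorankOneStructure k) (q p : Coord k) : ℝ :=
  (1 / 2) * ∑ i, (p ⬝ᵥ S.frame i q) ^ 2

/-- The fibre over `q` of the unit cotangent bundle `{2 H = 1}`. -/
def unitCovectors (S : CorankOneStructure k) (q : Coord k) : Set (Coord k) :=
  {p | 2 * S.hamiltonian q p = 1}

/-- `(x, p)` solves Hamilton's equations on `[0, T]` with initial condition `(q, p₀)`. -/
def IsHamiltonTrajectory (S : CorankOneStructure k) (T : ℝ) (q p₀ : Coord k)
    (x p : ℝ → Coord k) : Prop :=
  x 0 = q ∧ p 0 = p₀ ∧ ∀ t ∈ Set.Icc 0 T,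
    HasDerivWithinAt x
      (fun a => fderiv ℝ (fun p' => S.hamiltonian (x t) p') (p t) (Pi.single a 1))
      (Set.Icc 0 T) t ∧
    HasDerivWithinAt p
      (fun a => -fderiv ℝ (fun x' => S.hamiltonian x' (p t)) (x t) (Pi.single a 1))
      (Set.Icc 0 T) t

/-- The normal geodesic from `q` with initial covector `p₀` is defined up to time `T`. -/
def GeodesicDefined (S : CorankOneStructure k) (T : ℝ) (q p₀ : Coord k) : Prop :=
  ∃ x p : ℝ → Coord k, S.IsHamiltonTrajectory T q p₀ x p

open Classical in
/-- The exponential map: position at time `T` of the normal geodesic from `q` with initial covector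
`p₀` (unique, as Hamilton's equations are smooth); junk value `q` if it is not defined up to `T`. -/
noncomputable def normalExp (S : CorankOneStructure k) (q : Coord k) (T : ℝ) (p₀ : Coord k) :
    Coord k :=
  if h : S.GeodesicDefined T q p₀ then h.choose T else q

/-! ### Complements, adapted measures and the microscopic Laplacian -/

/-- `V` is a complement: a smooth sub-bundle of the tangent bundle (here of rank one) with
`T_q M = D_q ⊕ V_q` at every point. -/
def IsComplement (S : CorankOneStructure k) (V : Coord k → Submodule ℝ (Coord k)) : Prop :=
  (∀ q, IsCompl (S.distribution q) (V q)) ∧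
  ∀ q, ∃ U : Set (Coord k), IsOpen U ∧ q ∈ U ∧ ∃ X₀ : Coord k → Coord k,
    ContDiffOn ℝ ∞ X₀ U ∧ ∀ q' ∈ U, V q' = Submodule.span ℝ {X₀ q'}

end CorankOneStructure

/-- The uniform probability measure on the unit sphere of Euclidean `ℝ^k`. -/
noncomputable def uniformSphere (k : ℕ) :
    Measure (Metric.sphere (0 : EuclideanSpace ℝ (Fin k)) 1) :=
  ((volume : Measure (EuclideanSpace ℝ (Fin k))).toSphere Set.univ)⁻¹ •
    (volume : Measure (EuclideanSpace ℝ (Fin k))).toSphere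

namespace CorankOneStructure

variable {k : ℕ}

/-- `Φ` is the family of linear isometries from `ℝ^k` onto the spaces `h_q = V_q^⊥` of horizontal
covectors with scalar product `2 H`: `Φ q u` is the covector that annihilates `V_q` and has the
coordinates `⟨Φ q u, X_i⟩ = u_i` (it is unique as `T_q M = D_q ⊕ V_q`). -/
def IsHorizontalLift (S : CorankOneStructure k) (V : Coord k → Submodule ℝ (Coord k))
    (Φ : Coord k → EuclideanSpace ℝ (Fin k) → Coord k) : Prop :=
  ∀ q u, (∀ v ∈ V q, Φ q u ⬝ᵥ v = 0) ∧ ∀ i, Φ q u ⬝ᵥ S.frame i q = u i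

/-- The family of measures `μ q` on the fibres of the unit cotangent bundle (viewed as measures on
the spaces of covectors) is adapted to the splitting `TM = D ⊕ V`: under the identification
`S_q × v_q ≃ unitCovectors q`, `(u, v) ↦ u + v`, where `S_q` is the unit sphere of `h_q = V_q^⊥` and
`v_q = D_q^⊥`, it is the product of the uniform probability measure on `S_q` and a `2`-decreasing
probability measure `ν q` on `v_q`; and `q ↦ ∫ f² dμ q` is continuous for every continuous fibrewise
linear `f` on the cotangent bundle. -/
def IsAdapted (S : CorankOneStructure k) (V : Coord k → Submodule ℝ (Coord k))
    (μ : Coord k → Measure (Coord k)) : Prop :=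
  (∃ (Φ : Coord k → EuclideanSpace ℝ (Fin k) → Coord k) (ν : Coord k → Measure (Coord k)),
    S.IsHorizontalLift V Φ ∧
    ∀ q, IsProbabilityMeasure (ν q) ∧
      (∀ᵐ p ∂(ν q), ∀ v ∈ S.distribution q, p ⬝ᵥ v = 0) ∧
      (∀ w : Coord k, MemLp (fun p : Coord k => p ⬝ᵥ w) 2 (ν q)) ∧
      μ q = ((uniformSphere k).prod (ν q)).map (fun y => Φ q y.1.1 + y.2)) ∧
  ∀ f : Coord k → Coord k → ℝ, Continuous (fun y : Coord k × Coord k => f y.1 y.2) →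
    (∀ q, IsLinearMap ℝ (f q)) → Continuous fun q => ∫ p, f q p ^ 2 ∂(μ q)

/-- `L` is the microscopic Laplacian of the family of measures `μ`:
`(L φ)(q) = lim_{t → 0+} (2k / t²) ∫ (φ(exp_q(t, p)) - φ(q)) dμ_q(p)` for all smooth `φ` and all
`q`, where for small `t > 0` all the geodesics involved are defined up to time `t` and the integrand
is integrable. -/
def IsMicroLaplacian (S : CorankOneStructure k) (μ : Coord k → Measure (Coord k))
    (L : SmoothFun k → Coord k → ℝ) : Prop :=
  ∀ q, (∀ᶠ t in 𝓝[>] (0 : ℝ), ∀ p ∈ S.unitCovectors q, S.GeodesicDefined t q p) ∧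
    ∀ φ : SmoothFun k,
      (∀ᶠ t in 𝓝[>] (0 : ℝ), Integrable (fun p => φ.1 (S.normalExp q t p) - φ.1 q) (μ q)) ∧
      Tendsto (fun t : ℝ =>
          2 * (k : ℝ) / t ^ 2 * ∫ p, (φ.1 (S.normalExp q t p) - φ.1 q) ∂(μ q))
        (𝓝[>] 0) (𝓝 (L φ q))

end CorankOneStructure

/-! ### The example on `ℝ⁴`, with coordinates `x = q 0`, `y = q 1`, `z = q 2`, `w = q 3` -/

namespace QuasiContactExample

/-- `η = (g(z)/√2) (dw - (y/2) dx + (x/2) dy)`. -/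
noncomputable def eta (g : ℝ → ℝ) (q : Coord 3) : Coord 3 →L[ℝ] ℝ :=
  (g (q 2) / √2) • (ContinuousLinearMap.proj (R := ℝ) (φ := fun _ : Fin 4 => ℝ) 3
    - (q 1 / 2) • ContinuousLinearMap.proj (R := ℝ) (φ := fun _ : Fin 4 => ℝ) 0
    + (q 0 / 2) • ContinuousLinearMap.proj (R := ℝ) (φ := fun _ : Fin 4 => ℝ) 1)

/-- `X = (∂x + (y/2) ∂w)/√g`, `Y = (∂y - (x/2) ∂w)/√g`, `Z = ∂z/√g`. -/
noncomputable def frame (g : ℝ → ℝ) : Fin 3 → Coord 3 → Coord 3 :=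
  ![fun q => (1 / √(g (q 2))) • ![1, 0, 0, q 1 / 2],
    fun q => (1 / √(g (q 2))) • ![0, 1, 0, -(q 0 / 2)],
    fun q => (1 / √(g (q 2))) • ![0, 0, 1, 0]]

theorem contDiff_eta {g : ℝ → ℝ} (hg : ContDiff ℝ ∞ g) : ContDiff ℝ ∞ (eta g) := by
  unfold eta
  have h2 : ContDiff ℝ ∞ fun q : Coord 3 => g (q 2) := hg.comp (contDiff_apply ℝ ℝ 2)
  fun_prop

theorem contDiff_frame {g : ℝ → ℝ} (hg : ContDiff ℝ ∞ g) (hpos : ∀ z, 0 < g z) (i : Fin 3) :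
    ContDiff ℝ ∞ (frame g i) := by
  have h2 : ContDiff ℝ ∞ fun q : Coord 3 => 1 / √(g (q 2)) :=
    contDiff_const.div ((hg.comp (contDiff_apply ℝ ℝ 2)).sqrt fun q => (hpos _).ne')
      fun q => (Real.sqrt_pos.2 (hpos _)).ne'
  fin_cases i <;> simp only [frame] <;> refine h2.smul (contDiff_pi.2 fun j => ?_) <;>
    fin_cases j <;> simp <;> fun_prop

theorem eta_apply (g : ℝ → ℝ) (q v : Coord 3) :
    eta g q v = g (q 2) / √2 * (v 3 - q 1 / 2 * v 0 + q 0 / 2 * v 1) := by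
  simp [eta]
  ring

theorem linearIndependent_frame {g : ℝ → ℝ} (hpos : ∀ z, 0 < g z) (q : Coord 3) :
    LinearIndependent ℝ (fun i => frame g i q) := by
  have hs : √(g (q 2)) ≠ 0 := (Real.sqrt_pos.2 (hpos _)).ne'
  rw [Fintype.linearIndependent_iff]
  intro c hc i
  have h0 := congrFun hc 0
  have h1 := congrFun hc 1
  have h2 := congrFun hc 2
  simp [Fin.sum_univ_three, frame, hs] at h0 h1 h2
  fin_cases i <;> simp [h0, h1, h2]

theorem span_frame {g : ℝ → ℝ} (hpos : ∀ z, 0 < g z) (q : Coord 3) :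
    Submodule.span ℝ (Set.range fun i => frame g i q)
      = LinearMap.ker (eta g q : Coord 3 →ₗ[ℝ] ℝ) := by
  have hs : √(g (q 2)) ≠ 0 := (Real.sqrt_pos.2 (hpos _)).ne'
  have hg : g (q 2) ≠ 0 := (hpos _).ne'
  apply le_antisymm
  · rw [Submodule.span_le]
    rintro _ ⟨i, rfl⟩
    simp only [SetLike.mem_coe, LinearMap.mem_ker, ContinuousLinearMap.coe_coe, eta_apply]
    fin_cases i <;> simp [frame] <;> right <;> ring
  · intro v hv
    simp only [LinearMap.mem_ker, ContinuousLinearMap.coe_coe, eta_apply] at hv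
    have hv' : v 3 - q 1 / 2 * v 0 + q 0 / 2 * v 1 = 0 := by
      have : g (q 2) / √2 ≠ 0 := by positivity
      exact (mul_eq_zero.1 hv).resolve_left this
    rw [Submodule.mem_span_range_iff_exists_fun]
    refine ⟨fun i => √(g (q 2)) * v i.castSucc, ?_⟩
    ext j
    fin_cases j <;> simp [Fin.sum_univ_three, frame] <;> field_simp
    linarith

theorem eta_lieBracket {g : ℝ → ℝ} (hg : ContDiff ℝ ∞ g) (hpos : ∀ z, 0 < g z) (q : Coord 3) :
    eta g q (VectorField.lieBracket ℝ (frame g 0) (frame g 1) q) ≠ 0 := by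
  have hs : √(g (q 2)) ≠ 0 := (Real.sqrt_pos.2 (hpos _)).ne'
  have hc : ContDiff ℝ ∞ fun q : Coord 3 => 1 / √(g (q 2)) :=
    contDiff_const.div ((hg.comp (contDiff_apply ℝ ℝ 2)).sqrt fun q => (hpos _).ne')
      fun q => (Real.sqrt_pos.2 (hpos _)).ne'
  have hd : DifferentiableAt ℝ (fun q : Coord 3 => 1 / √(g (q 2))) q :=
    hc.contDiffAt.differentiableAt (by simp)
  have hA : HasFDerivAt (fun q : Coord 3 => (![1, 0, 0, q 1 / 2] : Coord 3))
      (ContinuousLinearMap.pi ![0, 0, 0,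
        (1 / 2 : ℝ) • ContinuousLinearMap.proj (R := ℝ) (φ := fun _ : Fin 4 => ℝ) 1]) q := by
    rw [hasFDerivAt_pi]
    intro j
    fin_cases j
    · exact hasFDerivAt_const _ _
    · exact hasFDerivAt_const _ _
    · exact hasFDerivAt_const _ _
    · have := (hasFDerivAt_apply (𝕜 := ℝ) (1 : Fin 4) q).const_mul (1 / 2 : ℝ)
      refine this.congr_of_eventuallyEq (Eventually.of_forall fun p => ?_)
      simp; ring
  have hB : HasFDerivAt (fun q : Coord 3 => (![0, 1, 0, -(q 0 / 2)] : Coord 3))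
      (ContinuousLinearMap.pi ![0, 0, 0,
        (-1 / 2 : ℝ) • ContinuousLinearMap.proj (R := ℝ) (φ := fun _ : Fin 4 => ℝ) 0]) q := by
    rw [hasFDerivAt_pi]
    intro j
    fin_cases j
    · exact hasFDerivAt_const _ _
    · exact hasFDerivAt_const _ _
    · exact hasFDerivAt_const _ _
    · have := (hasFDerivAt_apply (𝕜 := ℝ) (0 : Fin 4) q).const_mul (-1 / 2 : ℝ)
      refine this.congr_of_eventuallyEq (Eventually.of_forall fun p => ?_)
      simp; ring
  have hX := (hd.hasFDerivAt.smul hA).fderiv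
  have hY := (hd.hasFDerivAt.smul hB).fderiv
  have e0 : frame g 0 = fun q => (1 / √(g (q 2))) • (![1, 0, 0, q 1 / 2] : Coord 3) := rfl
  have e1 : frame g 1 = fun q => (1 / √(g (q 2))) • (![0, 1, 0, -(q 0 / 2)] : Coord 3) := rfl
  set D := fderiv ℝ (fun q : Coord 3 => 1 / √(g (q 2))) q
  have key : eta g q (VectorField.lieBracket ℝ (frame g 0) (frame g 1) q)
      = -(g (q 2) / √2 * (1 / √(g (q 2))) ^ 2) := by
    rw [VectorField.lieBracket, e0, e1]
    erw [hX, hY]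
    rw [eta_apply]
    simp [Matrix.vecHead, Matrix.vecTail]
    ring
  rw [key]
  have := hpos (q 2)
  have : 0 < g (q 2) / √2 * (1 / √(g (q 2))) ^ 2 := by positivity
  linarith

/-- The corank one sub-Riemannian structure of the example. -/
noncomputable def sr (g : ℝ → ℝ) (hg : ContDiff ℝ ∞ g) (hpos : ∀ z, 0 < g z) :
    CorankOneStructure 3 where
  form := eta g
  frame := frame g
  contDiff_form := contDiff_eta hg
  contDiff_frame := contDiff_frame hg hpos
  linearIndependent_frame := linearIndependent_frame hpos
  span_frame := span_frame hpos
  step_two := fun q => ⟨0, 1, eta_lieBracket hg hpos q⟩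

/-- The four-form `dx ∧ dy ∧ dz ∧ dw`, i.e. the determinant. -/
noncomputable def coordVolume : Coord 3 [⋀^Fin 4]→L[ℝ] ℝ :=
  { (Matrix.detRowAlternating : Coord 3 [⋀^Fin 4]→ₗ[ℝ] ℝ) with
    cont := Continuous.matrix_det (A := fun v : Fin 4 → Fin 4 → ℝ => Matrix.of v)
      continuous_id }

/-- The four-form `(g^(5/2)/√2) dx ∧ dy ∧ dz ∧ dw`. -/
noncomputable def poppForm (g : ℝ → ℝ) (q : Coord 3) : Coord 3 [⋀^Fin 4]→L[ℝ] ℝ :=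
  (g (q 2) ^ (5 / 2 : ℝ) / √2) • coordVolume

end QuasiContactExample

/-! Both operators are tested on the coordinate function `z`, where neither the sign of Popp's
volume nor the complement matters. The horizontal gradient of `z` is `∂z/g` and Popp's density is
proportional to `g^(5/2)`, so the macroscopic value is `g^(-5/2) (g^(3/2))' = (3/2) g'/g²`. Along a
unit speed geodesic with momentum `√g u` on the frame `√g X, √g Y, √g Z`, the initial value of `z''`
is `g'/(2g²) - u_z² g'/g²`. The mean of `u_z²` over the sphere is `1/3`, and the factor `2k/t²`
times `t²/2` is `3`, so the microscopic value is `(1/2) g'/g²`. The difference `g'/g²` is nonzero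
somewhere, since a strictly monotone function has a nonzero derivative at some point.

The longer part is that the microscopic limit exists and ignores the choice of measure, although the
unit cylinders are not compact. On the energy level `2H = 1` the pair `(z, p_z)` solves a planar
system that does not see the vertical momentum `p_w`. The momentum `p_w` is conserved and merely
rotates the other two momenta, by the angle `p_w ∫ dt/g`. Hence all unit geodesics from `q` exist
for a common time and stay in a common bounded set (`exists_unit_geodesics`). Their acceleration is
affine in `p_w` with bounded coefficients, so the second order remainder is at most `C (1 + |p_w|)
t²` (`exists_normalExp_expansion`). This is integrable for adapted measures, and dominated
convergence applies.

The first order term is odd on the sphere and integrates to zero. In the second order term the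
vertical part `v` of the covector enters only as `v_w` times a function odd in the spherical
variable `u`. It integrates to zero against the product measure, which leaves a spherical average
determined by the complement (`isSplitMeasure_of_isAdapted`). -/

namespace QuasiContactExample

/-! ### The kernel of `dη` on the distribution -/

variable {g : ℝ → ℝ}

/-- The contact form `dw - (y/2) dx + (x/2) dy` of the Heisenberg factor. -/
noncomputable def contact (q v : Coord 3) : ℝ := v 3 - q 1 / 2 * v 0 + q 0 / 2 * v 1

theorem eta_eq (g : ℝ → ℝ) (q v : Coord 3) : eta g q v = g (q 2) / √2 * contact q v :=
  eta_apply g q v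

theorem mem_distribution_iff (hg : ContDiff ℝ ∞ g) (hpos : ∀ z, 0 < g z) (q v : Coord 3) :
    v ∈ (sr g hg hpos).distribution q ↔ contact q v = 0 := by
  have : g (q 2) / √2 ≠ 0 := by have := hpos (q 2); positivity
  change eta g q v = 0 ↔ _
  rw [eta_eq, mul_eq_zero]
  simp [this]

theorem differentiable_of_contDiff_top {E F : Type*} [NormedAddCommGroup E] [NormedSpace ℝ E]
    [NormedAddCommGroup F] [NormedSpace ℝ F] {f : E → F} (hf : ContDiff ℝ ∞ f) :
    Differentiable ℝ f := hf.differentiable (by simp)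

theorem hasFDerivAt_comp_coord {f : ℝ → ℝ} {f' : ℝ} (q : Coord 3) (i : Fin 4)
    (hf : HasDerivAt f f' (q i)) :
    HasFDerivAt (fun p : Coord 3 => f (p i))
      (f' • ContinuousLinearMap.proj (R := ℝ) (φ := fun _ : Fin 4 => ℝ) i) q :=
  hf.comp_hasFDerivAt q (hasFDerivAt_apply (𝕜 := ℝ) i q)

theorem fderiv_eta_apply (hg : ContDiff ℝ ∞ g) (q v w : Coord 3) :
    fderiv ℝ (eta g) q v w = deriv g (q 2) * v 2 / √2 * contact q w
      + g (q 2) / √2 * (- (v 1) / 2 * w 0 + v 0 / 2 * w 1) := by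
  have h1 : fderiv ℝ (eta g) q v w = fderiv ℝ (fun p => eta g p w) q v := by
    have := ((differentiable_of_contDiff_top (contDiff_eta hg)) q).hasFDerivAt.clm_apply
      (hasFDerivAt_const w q)
    rw [this.fderiv]
    simp
  have h2 : HasFDerivAt (fun p : Coord 3 => g (p 2))
      (deriv g (q 2) • ContinuousLinearMap.proj (R := ℝ) (φ := fun _ : Fin 4 => ℝ) 2) q :=
    hasFDerivAt_comp_coord q 2 (differentiable_of_contDiff_top hg _).hasDerivAt
  have hc := fun i : Fin 4 => hasFDerivAt_apply (𝕜 := ℝ) (F' := fun _ : Fin 4 => ℝ) i q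
  have h3 := (h2.mul_const (√2)⁻¹).mul
    ((((hc 1).const_mul (-(w 0) / 2)).add ((hc 0).const_mul (w 1 / 2))).add_const (w 3))
  have h4 : (fun p => eta g p w) = fun p : Coord 3 =>
      g (p 2) * (√2)⁻¹ * (-(w 0) / 2 * p 1 + w 1 / 2 * p 0 + w 3) := by
    ext p; rw [eta_apply]; ring
  rw [h1, h4]
  erw [h3.fderiv]
  simp [contact]
  ring

/-- On the distribution the terms of `dη` containing `g'` carry a factor `contact` and vanish. What
remains is `(g/√2) dx ∧ dy`, whose kernel inside `D` is spanned by `∂z`. -/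
theorem isQuasiContact (hg : ContDiff ℝ ∞ g) (hpos : ∀ z, 0 < g z) :
    (sr g hg hpos).IsQuasiContact := by
  refine ⟨by decide, fun q => ?_⟩
  have hc : g (q 2) / √2 ≠ 0 := by have := hpos (q 2); positivity
  have key : (sr g hg hpos).kernelJ q = Submodule.span ℝ {(Pi.single 2 1 : Coord 3)} := by
    ext w
    have hd : ∀ v w, contact q v = 0 → contact q w = 0 →
        (sr g hg hpos).dForm q v w = g (q 2) / √2 * (v 0 * w 1 - v 1 * w 0) := by
      intro v w hv hw
      change fderiv ℝ (eta g) q v w - fderiv ℝ (eta g) q w v = _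
      rw [fderiv_eta_apply hg, fderiv_eta_apply hg, hv, hw]
      ring
    rw [Submodule.mem_span_singleton]
    constructor
    · rintro ⟨hw, h⟩
      rw [mem_distribution_iff] at hw
      -- Pairing with multiples of `X` and `Y` forces `w 1 = 0` and `w 0 = 0`; membership in `D`
      -- then gives `w 3 = 0`.
      have t0 : contact q ![1, 0, 0, q 1 / 2] = 0 := by simp [contact]
      have t1 : contact q ![0, 1, 0, -(q 0 / 2)] = 0 := by simp [contact]
      have h0 := h _ ((mem_distribution_iff hg hpos q _).2 t0)
      have h1 := h _ ((mem_distribution_iff hg hpos q _).2 t1)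
      rw [hd _ _ t0 hw] at h0
      rw [hd _ _ t1 hw] at h1
      have e1 := (mul_eq_zero.1 h0).resolve_left hc
      have e0 := (mul_eq_zero.1 h1).resolve_left hc
      simp at e0 e1
      simp [contact, e0, e1] at hw
      refine ⟨w 2, ?_⟩
      ext j
      fin_cases j <;> simp [e0, e1, hw]
    · rintro ⟨a, rfl⟩
      have hw : contact q (a • (Pi.single 2 1 : Coord 3)) = 0 := by simp [contact]
      refine ⟨(mem_distribution_iff hg hpos q _).2 hw, fun v hv => ?_⟩
      rw [hd _ _ ((mem_distribution_iff hg hpos q _).1 hv) hw]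
      simp
  rw [key]
  exact finrank_span_singleton (by simp)

/-! ### Popp's volume -/

/-- The frame without the conformal factor `1/√g`. -/
noncomputable def flatFrame : Fin 3 → Coord 3 → Coord 3 :=
  ![fun q => ![1, 0, 0, q 1 / 2], fun q => ![0, 1, 0, -(q 0 / 2)], fun _ => ![0, 0, 1, 0]]

theorem frame_eq (g : ℝ → ℝ) (i : Fin 3) (q : Coord 3) :
    frame g i q = (1 / √(g (q 2))) • flatFrame i q := by
  fin_cases i <;> rfl

theorem contact_flatFrame (q : Coord 3) (i : Fin 3) : contact q (flatFrame i q) = 0 := by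
  fin_cases i <;> simp [contact, flatFrame]

theorem contact_add (q v w : Coord 3) : contact q (v + w) = contact q v + contact q w := by
  simp [contact]; ring

theorem contact_smul (q : Coord 3) (a : ℝ) (v : Coord 3) :
    contact q (a • v) = a * contact q v := by
  simp [contact]; ring

/-- The differential of the flat frame fields. -/
noncomputable def flatFrameDeriv : Fin 3 → Coord 3 →L[ℝ] Coord 3 :=
  ![ContinuousLinearMap.pi ![0, 0, 0,
      (1 / 2 : ℝ) • ContinuousLinearMap.proj (R := ℝ) (φ := fun _ : Fin 4 => ℝ) 1],
    ContinuousLinearMap.pi ![0, 0, 0,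
      (-1 / 2 : ℝ) • ContinuousLinearMap.proj (R := ℝ) (φ := fun _ : Fin 4 => ℝ) 0], 0]

theorem hasFDerivAt_flatFrame (i : Fin 3) (q : Coord 3) :
    HasFDerivAt (flatFrame i) (flatFrameDeriv i) q := by
  have hc := fun i : Fin 4 => hasFDerivAt_apply (𝕜 := ℝ) (F' := fun _ : Fin 4 => ℝ) i q
  fin_cases i
  · refine hasFDerivAt_pi.2 fun j => ?_
    fin_cases j
    · exact hasFDerivAt_const _ _
    · exact hasFDerivAt_const _ _
    · exact hasFDerivAt_const _ _
    · refine ((hc 1).const_mul (1 / 2 : ℝ)).congr_of_eventuallyEq (Eventually.of_forall fun p => ?_)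
      simp [flatFrame]; ring
  · refine hasFDerivAt_pi.2 fun j => ?_
    fin_cases j
    · exact hasFDerivAt_const _ _
    · exact hasFDerivAt_const _ _
    · exact hasFDerivAt_const _ _
    · refine ((hc 0).const_mul (-1 / 2 : ℝ)).congr_of_eventuallyEq
        (Eventually.of_forall fun p => ?_)
      simp [flatFrame]; ring
  · exact hasFDerivAt_const _ _

/-- In the product rule the derivative of `1/√g` multiplies a horizontal vector, so `contact` kills
it. Modulo `D`, brackets therefore see the conformal factor only through its value. -/
theorem contact_fderiv_frame (hg : ContDiff ℝ ∞ g) (hpos : ∀ z, 0 < g z) (i : Fin 3)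
    (q v : Coord 3) :
    contact q (fderiv ℝ (frame g i) q v) = 1 / √(g (q 2)) * flatFrameDeriv i v 3 := by
  have hc : ContDiff ℝ ∞ fun q : Coord 3 => 1 / √(g (q 2)) :=
    contDiff_const.div ((hg.comp (contDiff_apply ℝ ℝ 2)).sqrt fun q => (hpos _).ne')
      fun q => (Real.sqrt_pos.2 (hpos _)).ne'
  have h := (differentiable_of_contDiff_top hc q).hasFDerivAt.smul (hasFDerivAt_flatFrame i q)
  have e : frame g i = fun q => (1 / √(g (q 2))) • flatFrame i q := by ext1 q; exact frame_eq g i q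
  have h0 : flatFrameDeriv i v 0 = 0 := by fin_cases i <;> simp [flatFrameDeriv]
  have h1 : flatFrameDeriv i v 1 = 0 := by fin_cases i <;> simp [flatFrameDeriv]
  rw [e]
  erw [h.fderiv]
  simp only [add_apply, smul_apply,
    ContinuousLinearMap.smulRight_apply]
  rw [contact_add, contact_smul, contact_smul, contact_flatFrame]
  simp [contact, h0, h1]

theorem contact_lieBracket (hg : ContDiff ℝ ∞ g) (hpos : ∀ z, 0 < g z) (i j : Fin 3)
    (q : Coord 3) :
    contact q (VectorField.lieBracket ℝ (frame g i) (frame g j) q) =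
      1 / g (q 2) * (![![0, -1, 0], ![1, 0, 0], ![0, 0, 0]] : Fin 3 → Fin 3 → ℝ) i j := by
  have hs : √(g (q 2)) * √(g (q 2)) = g (q 2) := Real.mul_self_sqrt (hpos _).le
  have hne : √(g (q 2)) ≠ 0 := (Real.sqrt_pos.2 (hpos _)).ne'
  rw [VectorField.lieBracket, sub_eq_add_neg, ← neg_one_smul ℝ, contact_add, contact_smul,
    contact_fderiv_frame hg hpos, contact_fderiv_frame hg hpos, frame_eq, frame_eq, ← hs]
  fin_cases i <;> fin_cases j <;> simp [flatFrameDeriv, flatFrame] <;> field_simp <;> norm_num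

theorem contact_sum (q : Coord 3) {ι : Type*} (s : Finset ι) (f : ι → Coord 3) :
    contact q (∑ i ∈ s, f i) = ∑ i ∈ s, contact q (f i) := by
  simp [contact, Finset.sum_add_distrib, Finset.mul_sum]

/-- Only `[X, Y]` leaves `D`, so lifting the class of `w` to a tensor `a` is the single linear
condition `a 1 0 - a 0 1 = g * contact q w`. The distance from the origin to this hyperplane is the
right side divided by `√2`, up to sign. -/
theorem isQuotientNorm_of_contact (hg : ContDiff ℝ ∞ g) (hpos : ∀ z, 0 < g z) (q w : Coord 3) :
    (sr g hg hpos).IsQuotientNorm q w (g (q 2) / √2 * |contact q w|) := by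
  have hp := hpos (q 2)
  have mem : ∀ a : Fin 3 → Fin 3 → ℝ,
      (∑ i, ∑ j, a i j • VectorField.lieBracket ℝ (frame g i) (frame g j) q) - w
        ∈ (sr g hg hpos).distribution q ↔ a 1 0 - a 0 1 = g (q 2) * contact q w := by
    intro a
    rw [mem_distribution_iff, sub_eq_add_neg, ← neg_one_smul ℝ, contact_add, contact_smul,
      contact_sum]
    simp only [contact_sum, contact_smul, contact_lieBracket hg hpos]
    simp only [Fin.sum_univ_three]
    simp
    field_simp
    constructor <;> intro h <;> linarith
  constructor
  -- The foot of the perpendicular is antisymmetric: the two entries share the prescribed difference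
  -- equally.
  · refine ⟨![![0, -(g (q 2) * contact q w / 2), 0], ![g (q 2) * contact q w / 2, 0, 0],
      ![0, 0, 0]], (mem _).2 ?_, ?_⟩
    · simp
    · simp only [Fin.sum_univ_three]
      symm
      have : g (q 2) / √2 * |contact q w| = √((g (q 2) / √2 * |contact q w|) ^ 2) := by
        rw [Real.sqrt_sq (by positivity)]
      rw [this]
      congr 1
      simp [mul_pow, div_pow, Real.sq_sqrt]
      ring
  · rintro s ⟨a, ha, rfl⟩
    have ha' := (mem a).1 ha
    apply Real.le_sqrt_of_sq_le
    have e : (g (q 2) / √2 * |contact q w|) ^ 2 = (a 1 0 - a 0 1) ^ 2 / 2 := by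
      rw [ha', mul_pow, div_pow, sq_abs, Real.sq_sqrt (by norm_num)]; ring
    rw [e]
    simp only [Fin.sum_univ_three]
    nlinarith [sq_nonneg (a 1 0 + a 0 1), sq_nonneg (a 0 0), sq_nonneg (a 0 2), sq_nonneg (a 1 1),
      sq_nonneg (a 1 2), sq_nonneg (a 2 0), sq_nonneg (a 2 1), sq_nonneg (a 2 2)]

theorem coordVolume_frame (hpos : ∀ z, 0 < g z) (q w : Coord 3) :
    coordVolume (Fin.snoc (fun i => frame g i q) w) = contact q w / √(g (q 2)) ^ 3 := by
  have hne : √(g (q 2)) ≠ 0 := (Real.sqrt_pos.2 (hpos _)).ne'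
  change Matrix.det (Fin.snoc (fun i => frame g i q) w : Fin 4 → Fin 4 → ℝ) = _
  have e : (Fin.snoc (fun i => frame g i q) w : Fin 4 → Fin 4 → ℝ) =
      Matrix.of ![frame g 0 q, frame g 1 q, frame g 2 q, w] := by
    ext i j
    fin_cases i <;> rfl
  rw [e, Matrix.det_succ_row_zero]
  simp [Fin.sum_univ_succ, Matrix.det_fin_three, frame, Fin.succAbove, contact]
  field_simp
  ring

theorem rpow_five_halves {x : ℝ} (hx : 0 < x) : x ^ (5 / 2 : ℝ) = √x ^ 5 := by
  rw [Real.sqrt_eq_rpow, ← Real.rpow_natCast, ← Real.rpow_mul hx.le]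
  norm_num

/-- The exponent `5/2` is `3/2 + 1`: each of the three frame fields contributes `1/√g` to the
determinant, and a transverse unit vector has `contact` equal to `±√2/g`. -/
theorem isPoppVolume_poppForm (hg : ContDiff ℝ ∞ g) (hpos : ∀ z, 0 < g z) :
    (sr g hg hpos).IsPoppVolume (poppForm g) := by
  constructor
  · have h2 : ContDiff ℝ ∞ fun q : Coord 3 => g (q 2) := hg.comp (contDiff_apply ℝ ℝ 2)
    exact ((h2.rpow_const_of_ne fun q => (hpos _).ne').div_const _).smul contDiff_const
  · intro q w hw
    have h1 : g (q 2) / √2 * |contact q w| = 1 :=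
      (isQuotientNorm_of_contact hg hpos q w).unique hw
    change |(g (q 2) ^ (5 / 2 : ℝ) / √2) * coordVolume (Fin.snoc (fun i => frame g i q) w)| = 1
    have hp := Real.sqrt_pos.2 (hpos (q 2))
    rw [coordVolume_frame hpos, rpow_five_halves (hpos _), abs_mul, abs_div _ (_ ^ 3),
      abs_of_pos (by positivity : 0 < √(g (q 2)) ^ 5 / √2),
      abs_of_pos (by positivity : 0 < √(g (q 2)) ^ 3), ← h1]
    have : g (q 2) = √(g (q 2)) ^ 2 := (Real.sq_sqrt (hpos _).le).symm
    rw [eq_comm]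
    nth_rw 1 [this]
    field_simp

/-! ### Divergence and the macroscopic Laplacian -/

theorem fourForm_eq_smul_coordVolume (F : Coord 3 [⋀^Fin 4]→L[ℝ] ℝ) :
    F = F (fun i => Pi.single i 1) • coordVolume := by
  have h := AlternatingMap.eq_smul_basis_det (Pi.basisFun ℝ (Fin 4)) F.toAlternatingMap
  ext v
  have hv := congrArg (fun f => f v) h
  simp only [AlternatingMap.smul_apply, Module.Basis.det_apply] at hv
  have e1 : F.toAlternatingMap (Pi.basisFun ℝ (Fin 4)) = F (fun i => Pi.single i 1) := by
    change F _ = _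
    congr 1
    ext1 i
    simp
  rw [e1] at hv
  have e2 : (Pi.basisFun ℝ (Fin 4)).toMatrix v = (Matrix.of v).transpose := by
    ext i j; simp [Module.Basis.toMatrix_apply]
  rw [e2, Matrix.det_transpose] at hv
  exact hv

theorem fourForm_update (F : Coord 3 [⋀^Fin 4]→L[ℝ] ℝ) (i : Fin 4) (v : Coord 3) :
    F (Function.update (fun i => Pi.single i 1) i v) = v i * F (fun i => Pi.single i 1) := by
  have h := congrArg (fun f => f (Function.update (fun i => Pi.single i 1) i v))
    (fourForm_eq_smul_coordVolume F)
  have e : coordVolume (Function.update (fun i => Pi.single i 1) i v) = v i := by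
    change Matrix.det (Matrix.of (Function.update (fun i => Pi.single i 1) i v)) = _
    have : (Matrix.of (Function.update (fun i => Pi.single i 1) i v) : Matrix (Fin 4) (Fin 4) ℝ) =
        (1 : Matrix (Fin 4) (Fin 4) ℝ).updateRow i v := by
      ext a b
      by_cases ha : a = i
      · subst ha; simp
      · simp [ha, Matrix.one_apply, Pi.single_apply, eq_comm]
    rw [this, ← Matrix.cramer_transpose_apply, Matrix.transpose_one, Matrix.cramer_one]
    rfl
  rw [h]
  change F _ * coordVolume _ = _
  rw [e, mul_comm]

/-- Bracketing `X` with a constant field `e_i` gives `-∂_i X`, and inserting this in slot `i` of a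
top form extracts its `i`-th component. The result is the classical formula `X(log Ω) + ∑ ∂_i X_i`.
-/
theorem divergence_eq {Ω : Coord 3 → Coord 3 [⋀^Fin 4]→L[ℝ] ℝ} {X : Coord 3 → Coord 3}
    {q : Coord 3} (h0 : Ω q (fun i => Pi.single i 1) ≠ 0) :
    divergence Ω X q = fderiv ℝ (fun p => Ω p (fun i => Pi.single i 1)) q (X q)
      / Ω q (fun i => Pi.single i 1) + ∑ i, fderiv ℝ X q (Pi.single i 1) i := by
  rw [divergence, lieDerivForm, sub_div, sub_eq_add_neg, ← neg_div, ← Finset.sum_neg_distrib,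
    Finset.sum_div]
  congr 1
  refine Finset.sum_congr rfl fun i _ => ?_
  erw [fourForm_update]
  rw [VectorField.lieBracket]
  simp
  field_simp

/-- Squaring removes the sign of the form, which the definition leaves free at each point. The test
vector `(√2/g) ∂w` represents a unit class. -/
theorem isPoppVolume_coord_sq (hg : ContDiff ℝ ∞ g) (hpos : ∀ z, 0 < g z)
    {P : Coord 3 → Coord 3 [⋀^Fin 4]→L[ℝ] ℝ} (hP : (sr g hg hpos).IsPoppVolume P)
    (q : Coord 3) : P q (fun i => Pi.single i 1) ^ 2 = g (q 2) ^ 5 / 2 := by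
  have hp := hpos (q 2)
  have hc : contact q (Pi.single 3 (√2 / g (q 2))) = √2 / g (q 2) := by simp [contact]
  have h1 := isQuotientNorm_of_contact hg hpos q (Pi.single 3 (√2 / g (q 2)))
  rw [hc, abs_of_pos (by positivity)] at h1
  have h2 := hP.2 q _ (by convert h1 using 1; field_simp)
  have h3 := congrArg (fun f => f (Fin.snoc (fun i => frame g i q)
    (Pi.single 3 (√2 / g (q 2))))) (fourForm_eq_smul_coordVolume (P q))
  change P q (Fin.snoc (fun i => frame g i q) (Pi.single 3 (√2 / g (q 2)))) = _ * _ at h3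
  erw [h3, coordVolume_frame hpos, hc] at h2
  have h4 := congrArg (· ^ 2) h2
  simp only [sq_abs, mul_pow, div_pow, one_pow] at h4
  rw [Real.sq_sqrt (by norm_num : (0 : ℝ) ≤ 2), ← pow_mul, mul_comm 3 2, pow_mul,
    Real.sq_sqrt hp.le] at h4
  field_simp at h4 ⊢
  linarith

/-- The coordinate function `z`. -/
noncomputable def coordZ : SmoothFun 3 := ⟨fun q => q 2, contDiff_apply ℝ ℝ 2⟩

theorem fderiv_coordZ (q : Coord 3) :
    fderiv ℝ coordZ.1 q = ContinuousLinearMap.proj (R := ℝ) (φ := fun _ : Fin 4 => ℝ) 2 :=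
  (hasFDerivAt_apply (𝕜 := ℝ) (F' := fun _ : Fin 4 => ℝ) 2 q).fderiv

theorem macroLaplacian_coordZ (hg : ContDiff ℝ ∞ g) (hpos : ∀ z, 0 < g z)
    {P : Coord 3 → Coord 3 [⋀^Fin 4]→L[ℝ] ℝ} (hP : (sr g hg hpos).IsPoppVolume P)
    (q : Coord 3) :
    (sr g hg hpos).macroLaplacian P coordZ q = 3 / 2 * deriv g (q 2) / g (q 2) ^ 2 := by
  have hp := hpos (q 2)
  have hX : (sr g hg hpos).horizontalGradient coordZ.1
      = fun q => (g (q 2))⁻¹ • (Pi.single 2 1 : Coord 3) := by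
    ext1 q
    have hp := hpos (q 2)
    have hs := Real.sqrt_pos.2 hp
    change ∑ i, fderiv ℝ coordZ.1 q (frame g i q) • frame g i q = _
    simp only [fderiv_coordZ, Fin.sum_univ_three]
    ext j
    have hs2 := Real.mul_self_sqrt hp.le
    have hi : (√(g (q 2)))⁻¹ * (√(g (q 2)))⁻¹ = (g (q 2))⁻¹ := by rw [← mul_inv, hs2]
    fin_cases j <;> simp [frame, hi]
  have hgd : HasFDerivAt (fun p : Coord 3 => g (p 2))
      (deriv g (q 2) • ContinuousLinearMap.proj (R := ℝ) (φ := fun _ : Fin 4 => ℝ) 2) q :=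
    hasFDerivAt_comp_coord q 2 (differentiable_of_contDiff_top hg _).hasDerivAt
  set e : Fin 4 → Coord 3 := fun i => Pi.single i 1 with he
  have hsq := isPoppVolume_coord_sq hg hpos hP
  have hne : P q e ≠ 0 := by
    intro h
    have := hsq q
    rw [h] at this
    have : 0 < g (q 2) ^ 5 / 2 := by positivity
    simp_all
  have hPd : DifferentiableAt ℝ (fun p => P p e) q := by
    have h1 : DifferentiableAt ℝ P q := differentiable_of_contDiff_top hP.1 q
    exact ((ContinuousAlternatingMap.apply ℝ (Coord 3) ℝ e).differentiableAt.comp q h1)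
  -- Differentiating the squared density yields its logarithmic derivative without first fixing a
  -- sign.
  have hd : 2 * P q e * fderiv ℝ (fun p => P p e) q (Pi.single 2 1)
      = 5 / 2 * g (q 2) ^ 4 * deriv g (q 2) := by
    have h1 := (hPd.hasFDerivAt.pow 2).fderiv
    have h2 := ((hgd.pow 5).mul_const (2⁻¹ : ℝ)).fderiv
    have h3 : (fun p => P p e ^ 2) = fun p => g (p 2) ^ 5 * 2⁻¹ := by
      ext p; rw [hsq]; ring
    erw [h3, h2] at h1
    have h4 := congrArg (fun f => f (Pi.single 2 1)) h1
    simp at h4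
    linarith
  rw [CorankOneStructure.macroLaplacian, hX, divergence_eq hne]
  have h5 : HasFDerivAt (fun p : Coord 3 => (g (p 2))⁻¹ • (Pi.single 2 1 : Coord 3))
      _ q := (hasFDerivAt_comp_coord q 2
        ((differentiable_of_contDiff_top hg _).hasDerivAt.inv hp.ne')).smul_const _
  rw [h5.fderiv, map_smul, Fin.sum_univ_four]
  have h6 : fderiv ℝ (fun p => P p e) q (Pi.single 2 1)
      = 5 / 4 * g (q 2) ^ 4 * deriv g (q 2) / P q e := by
    field_simp; linarith
  rw [← he, h6]
  simp
  have h7 := hsq q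
  field_simp
  have h8 : g (q 2) ^ 5 = 2 * P q e ^ 2 := by linarith
  linear_combination (10 : ℝ) * deriv g (q 2) * h8

end QuasiContactExample

/-! ### Moments of the uniform measure on the sphere -/

/-- The spherical measure of a set is, up to a dimensional factor, the volume of the cone over it. A
linear isometry commutes with forming cones, so invariance of the volume passes to the sphere. -/
theorem MeasureTheory.Measure.map_toSphere_linearIsometryEquiv {E : Type*} [NormedAddCommGroup E]
    [NormedSpace ℝ E] [MeasurableSpace E] [BorelSpace E] {μ : Measure E} (e : E ≃ₗᵢ[ℝ] E)
    (he : MeasurePreserving e μ μ) :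
    MeasurePreserving (fun x : Metric.sphere (0 : E) 1 =>
      (⟨e x, by simp⟩ : Metric.sphere (0 : E) 1)) μ.toSphere μ.toSphere := by
  have hm : Measurable (fun x : Metric.sphere (0 : E) 1 =>
      (⟨e x, by simp⟩ : Metric.sphere (0 : E) 1)) :=
    (Continuous.subtype_mk (e.continuous.comp continuous_subtype_val) _).measurable
  refine ⟨hm, ?_⟩
  ext s hs
  rw [Measure.map_apply hm hs, Measure.toSphere_apply' _ (hm hs), Measure.toSphere_apply' _ hs]
  congr 1
  conv_rhs => rw [← he.measure_preimage_emb e.toHomeomorph.measurableEmbedding]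
  congr 1
  ext x
  simp only [Set.mem_smul, Set.mem_image, Set.mem_preimage]
  constructor
  · rintro ⟨r, hr, _, ⟨y, hy, rfl⟩, rfl⟩
    exact ⟨r, hr, _, ⟨_, hy, rfl⟩, by simp⟩
  · rintro ⟨r, hr, _, ⟨y, hy, rfl⟩, h⟩
    refine ⟨r, hr, e.symm y, ⟨⟨e.symm y, by simp⟩, by simpa using hy, rfl⟩, ?_⟩
    apply e.injective
    simpa using h

theorem isProbabilityMeasure_uniformSphere {k : ℕ} (hk : k ≠ 0) :
    IsProbabilityMeasure (uniformSphere k) := by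
  have : Nonempty (Fin k) := ⟨⟨0, Nat.pos_of_ne_zero hk⟩⟩
  have h0 : (volume : Measure (EuclideanSpace ℝ (Fin k))).toSphere ≠ 0 := Measure.toSphere_ne_zero _
  refine ⟨?_⟩
  rw [uniformSphere, Measure.smul_apply, smul_eq_mul]
  exact ENNReal.inv_mul_cancel (by rwa [Measure.measure_univ_ne_zero]) (measure_ne_top _ _)

instance : IsProbabilityMeasure (uniformSphere 3) := isProbabilityMeasure_uniformSphere (by norm_num)

theorem measurePreserving_uniformSphere {k : ℕ}
    (e : EuclideanSpace ℝ (Fin k) ≃ₗᵢ[ℝ] EuclideanSpace ℝ (Fin k)) :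
    MeasurePreserving (fun x : Metric.sphere (0 : EuclideanSpace ℝ (Fin k)) 1 =>
      (⟨e x, by simp⟩ : Metric.sphere (0 : EuclideanSpace ℝ (Fin k)) 1))
      (uniformSphere k) (uniformSphere k) :=
  (Measure.map_toSphere_linearIsometryEquiv e e.measurePreserving).smul_measure _

theorem integral_uniformSphere_comp {k : ℕ}
    (e : EuclideanSpace ℝ (Fin k) ≃ₗᵢ[ℝ] EuclideanSpace ℝ (Fin k))
    (f : EuclideanSpace ℝ (Fin k) → ℝ) :
    ∫ x, f (e x.1) ∂(uniformSphere k) = ∫ x, f x.1 ∂(uniformSphere k) := by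
  have hemb : MeasurableEmbedding (fun x : Metric.sphere (0 : EuclideanSpace ℝ (Fin k)) 1 =>
      (⟨e x, by simp⟩ : Metric.sphere (0 : EuclideanSpace ℝ (Fin k)) 1)) := by
    refine (Topology.IsClosedEmbedding.measurableEmbedding ?_)
    refine Continuous.isClosedEmbedding
      (Continuous.subtype_mk (e.continuous.comp continuous_subtype_val) _) fun x y h => ?_
    simpa [Subtype.ext_iff] using h
  exact (measurePreserving_uniformSphere e).integral_comp hemb (fun x => f x.1)

theorem integral_uniformSphere_of_odd {k : ℕ} (f : EuclideanSpace ℝ (Fin k) → ℝ)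
    (hf : ∀ u, f (-u) = -f u) : ∫ x, f x.1 ∂(uniformSphere k) = 0 := by
  have h := integral_uniformSphere_comp (LinearIsometryEquiv.neg ℝ) f
  simp only [LinearIsometryEquiv.coe_neg, hf, integral_neg] at h
  linarith

theorem Continuous.integrable_uniformSphere {F : Type*} [NormedAddCommGroup F]
    {f : Metric.sphere (0 : EuclideanSpace ℝ (Fin 3)) 1 → F} (hf : Continuous f) :
    Integrable f (uniformSphere 3) :=
  hf.integrable_of_hasCompactSupport (HasCompactSupport.of_compactSpace f)

/-- Swapping coordinates is an isometry, so the three second moments agree, and they add up to one.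
-/
theorem integral_uniformSphere_coord_sq (i : Fin 3) :
    ∫ x, x.1 i ^ 2 ∂(uniformSphere 3) = 1 / 3 := by
  have hc : ∀ i : Fin 3, Continuous
      fun x : Metric.sphere (0 : EuclideanSpace ℝ (Fin 3)) 1 => x.1 i ^ 2 := fun i => by fun_prop
  have h : ∀ j, ∫ x, x.1 j ^ 2 ∂(uniformSphere 3) = ∫ x, x.1 i ^ 2 ∂(uniformSphere 3) := by
    intro j
    have := integral_uniformSphere_comp (LinearIsometryEquiv.piLpCongrLeft 2 ℝ ℝ (Equiv.swap i j))
      (fun u => u i ^ 2)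
    simpa [LinearIsometryEquiv.piLpCongrLeft_apply] using this
  have hs : ∫ x : Metric.sphere (0 : EuclideanSpace ℝ (Fin 3)) 1,
      ∑ j, x.1 j ^ 2 ∂(uniformSphere 3) = 1 := by
    have : ∀ x : Metric.sphere (0 : EuclideanSpace ℝ (Fin 3)) 1, ∑ j, x.1 j ^ 2 = 1 := by
      intro x
      have := EuclideanSpace.norm_sq_eq x.1
      simpa using this.symm
    simp [this]
  rw [integral_finsetSum _ fun j _ => (hc j).integrable_uniformSphere] at hs
  simp only [h, Finset.sum_const, Finset.card_univ, Fintype.card_fin, nsmul_eq_mul] at hs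
  push_cast at hs
  linarith

/-! ### Hamilton's equations -/

/-- A continuously differentiable vector field is Lipschitz on every closed ball. -/
theorem ContDiff.exists_lipschitzOnWith_closedBall {E F : Type*} [NormedAddCommGroup E]
    [NormedSpace ℝ E] [ProperSpace E] [NormedAddCommGroup F] [NormedSpace ℝ F] {f : E → F}
    (hf : ContDiff ℝ 1 f) (x : E) (r : ℝ) :
    ∃ K, LipschitzOnWith K f (Metric.closedBall x r) := by
  have hl : LocallyLipschitz f := hf.locallyLipschitz
  exact hl.locallyLipschitzOn.exists_lipschitzOnWith_of_compact (isCompact_closedBall x r)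

/-- Two solutions on `[0, T]` of an autonomous continuously differentiable differential equation
with the same initial value agree. -/
theorem ContDiff.ode_solution_unique {E : Type*} [NormedAddCommGroup E] [NormedSpace ℝ E]
    [ProperSpace E] {v : E → E} (hv : ContDiff ℝ 1 v) {T : ℝ} {f h : ℝ → E}
    (hf : ∀ t ∈ Set.Icc 0 T, HasDerivWithinAt f (v (f t)) (Set.Icc 0 T) t)
    (hh : ∀ t ∈ Set.Icc 0 T, HasDerivWithinAt h (v (h t)) (Set.Icc 0 T) t)
    (h0 : f 0 = h 0) : Set.EqOn f h (Set.Icc 0 T) := by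
  have cf : ContinuousOn f (Set.Icc 0 T) := fun t ht => (hf t ht).continuousWithinAt
  have ch : ContinuousOn h (Set.Icc 0 T) := fun t ht => (hh t ht).continuousWithinAt
  -- Both curves have compact image, so they lie in a common ball, on which the field has a global
  -- Lipschitz constant.
  obtain ⟨r, hr⟩ := ((isCompact_Icc.image_of_continuousOn cf).union
    (isCompact_Icc.image_of_continuousOn ch)).isBounded.subset_closedBall 0
  obtain ⟨K, hK⟩ := hv.exists_lipschitzOnWith_closedBall 0 r
  have mono : ∀ t ∈ Set.Ico 0 T, Set.Icc 0 T ∈ 𝓝[Set.Ici t] t := fun t ht =>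
    mem_of_superset (Icc_mem_nhdsGE ht.2) (Set.Icc_subset_Icc_left ht.1)
  exact ODE_solution_unique_of_mem_Icc_right (v := fun _ => v)
    (s := fun _ => Metric.closedBall 0 r) (fun _ _ => hK) cf
    (fun t ht => (hf t (Set.Ico_subset_Icc_self ht)).mono_of_mem_nhdsWithin (mono t ht))
    (fun t ht => hr (Or.inl ⟨t, Set.Ico_subset_Icc_self ht, rfl⟩)) ch
    (fun t ht => (hh t (Set.Ico_subset_Icc_self ht)).mono_of_mem_nhdsWithin (mono t ht))
    (fun t ht => hr (Or.inr ⟨t, Set.Ico_subset_Icc_self ht, rfl⟩)) h0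

/-- Local flow of a continuously differentiable vector field that is bounded on a ball: on a smaller
ball of initial values, solutions exist for a common time and depend continuously on the initial
value. -/
theorem ContDiff.exists_flow_closedBall {E : Type*} [NormedAddCommGroup E] [NormedSpace ℝ E]
    [ProperSpace E] {v : E → E} (hv : ContDiff ℝ 1 v) (x₀ : E) {r : ℝ} (hr : 0 ≤ r) :
    ∃ T > 0, ∃ α : E × ℝ → E,
      (∀ x ∈ Metric.closedBall x₀ r, α (x, 0) = x ∧ ∀ t ∈ Set.Icc 0 T,
        HasDerivWithinAt (fun t => α (x, t)) (v (α (x, t))) (Set.Icc 0 T) t) ∧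
      ContinuousOn α (Metric.closedBall x₀ r ×ˢ Set.Icc 0 T) := by
  obtain ⟨K, hK⟩ := hv.exists_lipschitzOnWith_closedBall x₀ (r + 1)
  obtain ⟨L, hL⟩ := (isCompact_closedBall x₀ (r + 1)).exists_bound_of_continuousOn
    hv.continuous.continuousOn
  have hL0 : 0 ≤ L := (norm_nonneg _).trans (hL x₀ (Metric.mem_closedBall_self (by linarith)))
  -- A solution starting in the ball of radius `r` has speed at most `L` while it remains in the
  -- ball of radius `r + 1`. In time `1/(L + 1)` it moves less than the spare distance `1`.
  have hT : 0 < 1 / (L + 1) := by positivity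
  have hpl : IsPicardLindelof (fun _ => v) (tmin := 0) (tmax := 1 / (L + 1))
      ⟨0, Set.left_mem_Icc.2 hT.le⟩ x₀ ⟨r + 1, by linarith⟩ ⟨r, hr⟩ ⟨L, hL0⟩ K := by
    refine IsPicardLindelof.of_time_independent hL hK ?_
    change L * max (1 / (L + 1) - 0) (0 - 0) ≤ r + 1 - r
    rw [sub_zero, sub_zero, add_sub_cancel_left, max_eq_left (by simpa using hT.le), mul_one_div, div_le_one (by positivity)]
    linarith
  obtain ⟨α, h1, h2⟩ := hpl.exists_forall_mem_closedBall_eq_hasDerivWithinAt_continuousOn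
  exact ⟨_, hT, α, h1, h2⟩

/-! ### Hamilton's equations of the example in explicit form -/

namespace QuasiContactExample

variable {g : ℝ → ℝ}

/-- The Hamiltonian of `∂x + (y/2) ∂w`. -/
noncomputable def momX (q p : Coord 3) : ℝ := p 0 + q 1 / 2 * p 3

/-- The Hamiltonian of `∂y - (x/2) ∂w`. -/
noncomputable def momY (q p : Coord 3) : ℝ := p 1 - q 0 / 2 * p 3

theorem dotProduct_frame (g : ℝ → ℝ) (q p : Coord 3) (i : Fin 3) :
    p ⬝ᵥ frame g i q = 1 / √(g (q 2)) * ![momX q p, momY q p, p 2] i := by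
  fin_cases i <;> simp [dotProduct, Fin.sum_univ_four, frame, momX, momY] <;> ring

theorem two_mul_hamiltonian (hg : ContDiff ℝ ∞ g) (hpos : ∀ z, 0 < g z) (q p : Coord 3) :
    2 * (sr g hg hpos).hamiltonian q p
      = (momX q p ^ 2 + momY q p ^ 2 + p 2 ^ 2) * (g (q 2))⁻¹ := by
  have hs : √(g (q 2)) ^ 2 = g (q 2) := Real.sq_sqrt (hpos _).le
  change 2 * (1 / 2 * ∑ i, (p ⬝ᵥ frame g i q) ^ 2) = _
  simp only [dotProduct_frame, Fin.sum_univ_three, mul_pow, div_pow, hs]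
  simp
  ring

theorem mem_unitCovectors_iff (hg : ContDiff ℝ ∞ g) (hpos : ∀ z, 0 < g z) (q p : Coord 3) :
    p ∈ (sr g hg hpos).unitCovectors q ↔ momX q p ^ 2 + momY q p ^ 2 + p 2 ^ 2 = g (q 2) := by
  change 2 * (sr g hg hpos).hamiltonian q p = 1 ↔ _
  rw [two_mul_hamiltonian, mul_inv_eq_one₀ (hpos _).ne']

/-- The velocity of a normal geodesic. -/
noncomputable def velocity (g : ℝ → ℝ) (q p : Coord 3) : Coord 3 :=
  (g (q 2))⁻¹ • ![momX q p, momY q p, p 2, (q 1 * momX q p - q 0 * momY q p) / 2]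

/-- The derivative of the covector along a normal geodesic. -/
noncomputable def force (g : ℝ → ℝ) (q p : Coord 3) : Coord 3 :=
  ![momY q p * p 3 / 2 * (g (q 2))⁻¹, -(momX q p * p 3) / 2 * (g (q 2))⁻¹,
    deriv g (q 2) / 2 * (g (q 2))⁻¹ ^ 2 * (momX q p ^ 2 + momY q p ^ 2 + p 2 ^ 2), 0]

theorem fderiv_hamiltonian_momentum (hg : ContDiff ℝ ∞ g) (hpos : ∀ z, 0 < g z) (q p : Coord 3) :
    (fun a => fderiv ℝ (fun p' => (sr g hg hpos).hamiltonian q p') p (Pi.single a 1))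
      = velocity g q p := by
  have e : (fun p' => (sr g hg hpos).hamiltonian q p') = fun p' : Coord 3 =>
      ((p' 0 + q 1 / 2 * p' 3) ^ 2 + (p' 1 - q 0 / 2 * p' 3) ^ 2 + p' 2 ^ 2)
        * ((g (q 2))⁻¹ / 2) := by
    ext p'
    have := two_mul_hamiltonian hg hpos q p'
    simp only [momX, momY] at this
    linarith
  have hc := fun i : Fin 4 => hasFDerivAt_apply (𝕜 := ℝ) (F' := fun _ : Fin 4 => ℝ) i p
  have h := ((((hc 0).add ((hc 3).const_mul (q 1 / 2))).pow 2).add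
    (((hc 1).sub ((hc 3).const_mul (q 0 / 2))).pow 2)).add ((hc 2).pow 2)
  have h' := (h.mul_const ((g (q 2))⁻¹ / 2)).fderiv
  ext a
  rw [e]
  erw [h']
  fin_cases a <;> simp [velocity, momX, momY] <;> ring

theorem fderiv_hamiltonian_position (hg : ContDiff ℝ ∞ g) (hpos : ∀ z, 0 < g z) (q p : Coord 3) :
    (fun a => -fderiv ℝ (fun x' => (sr g hg hpos).hamiltonian x' p) q (Pi.single a 1))
      = force g q p := by
  have e : (fun q' => (sr g hg hpos).hamiltonian q' p) = fun q' : Coord 3 =>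
      ((p 0 + p 3 / 2 * q' 1) ^ 2 + (p 1 - p 3 / 2 * q' 0) ^ 2 + p 2 ^ 2)
        * ((g (q' 2))⁻¹ * (1 / 2)) := by
    ext p'
    have := two_mul_hamiltonian hg hpos p' p
    simp only [momX, momY] at this
    linarith
  have hc := fun i : Fin 4 => hasFDerivAt_apply (𝕜 := ℝ) (F' := fun _ : Fin 4 => ℝ) i q
  have hp := hpos (q 2)
  have hgi := hasFDerivAt_comp_coord q 2
    ((differentiable_of_contDiff_top hg (q 2)).hasDerivAt.inv hp.ne')
  have h := (((((hc 1).const_mul (p 3 / 2)).const_add (p 0)).pow 2).add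
    ((((hc 0).const_mul (p 3 / 2)).const_sub (p 1)).pow 2)).add_const (p 2 ^ 2)
  have h' := (h.mul (hgi.mul_const (1 / 2 : ℝ))).fderiv
  ext a
  rw [e]
  erw [h']
  fin_cases a <;> simp [force, momX, momY] <;> field_simp

theorem isHamiltonTrajectory_iff (hg : ContDiff ℝ ∞ g) (hpos : ∀ z, 0 < g z) (T : ℝ)
    (q p₀ : Coord 3) (x p : ℝ → Coord 3) :
    (sr g hg hpos).IsHamiltonTrajectory T q p₀ x p ↔ x 0 = q ∧ p 0 = p₀ ∧ ∀ t ∈ Set.Icc 0 T,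
      HasDerivWithinAt x (velocity g (x t) (p t)) (Set.Icc 0 T) t ∧
      HasDerivWithinAt p (force g (x t) (p t)) (Set.Icc 0 T) t := by
  simp only [CorankOneStructure.IsHamiltonTrajectory, fderiv_hamiltonian_momentum,
    fderiv_hamiltonian_position]

theorem contDiff_hamiltonField (hg : ContDiff ℝ ∞ g) (hpos : ∀ z, 0 < g z) :
    ContDiff ℝ 1 fun y : Coord 3 × Coord 3 => (velocity g y.1 y.2, force g y.1 y.2) := by
  have c1 : ∀ i : Fin 4, ContDiff ℝ 1 fun y : Coord 3 × Coord 3 => y.1 i := fun i =>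
    (contDiff_apply ℝ ℝ i).comp contDiff_fst
  have c2 : ∀ i : Fin 4, ContDiff ℝ 1 fun y : Coord 3 × Coord 3 => y.2 i := fun i =>
    (contDiff_apply ℝ ℝ i).comp contDiff_snd
  have hd : ContDiff ℝ ∞ (deriv g) := (contDiff_infty_iff_deriv.1 hg).2
  have hgi : ContDiff ℝ 1 fun y : Coord 3 × Coord 3 => (g (y.1 2))⁻¹ :=
    ((hg.of_le (by simp)).comp (c1 2)).inv fun y => (hpos _).ne'
  have hdg : ContDiff ℝ 1 fun y : Coord 3 × Coord 3 => deriv g (y.1 2) :=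
    (hd.of_le (by simp)).comp (c1 2)
  have hX : ContDiff ℝ 1 fun y : Coord 3 × Coord 3 => momX y.1 y.2 :=
    (c2 0).add (((c1 1).div_const 2).mul (c2 3))
  have hY : ContDiff ℝ 1 fun y : Coord 3 × Coord 3 => momY y.1 y.2 :=
    (c2 1).sub (((c1 0).div_const 2).mul (c2 3))
  refine ContDiff.prodMk (hgi.smul (contDiff_pi.2 fun j => ?_)) (contDiff_pi.2 fun j => ?_)
  · fin_cases j
    · exact hX
    · exact hY
    · exact c2 2
    · exact (((c1 1).mul hX).sub ((c1 0).mul hY)).div_const 2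
  · fin_cases j
    · exact ((hY.mul (c2 3)).div_const 2).mul hgi
    · exact (((hX.mul (c2 3)).neg).div_const 2).mul hgi
    · exact ((hdg.div_const 2).mul (hgi.pow 2)).mul (((hX.pow 2).add (hY.pow 2)).add ((c2 2).pow 2))
    · exact contDiff_const

theorem isHamiltonTrajectory_unique (hg : ContDiff ℝ ∞ g) (hpos : ∀ z, 0 < g z) {T : ℝ}
    {q p₀ : Coord 3} {x p x' p' : ℝ → Coord 3}
    (h : (sr g hg hpos).IsHamiltonTrajectory T q p₀ x p)
    (h' : (sr g hg hpos).IsHamiltonTrajectory T q p₀ x' p') : Set.EqOn x x' (Set.Icc 0 T) := by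
  rw [isHamiltonTrajectory_iff] at h h'
  have := (contDiff_hamiltonField hg hpos).ode_solution_unique
    (f := fun t => (x t, p t)) (h := fun t => (x' t, p' t))
    (fun t ht => (h.2.2 t ht).1.prodMk (h.2.2 t ht).2)
    (fun t ht => (h'.2.2 t ht).1.prodMk (h'.2.2 t ht).2)
    (by simp [h.1, h.2.1, h'.1, h'.2.1])
  exact fun t ht => congrArg Prod.fst (this ht)

/-- `normalExp` picks an arbitrary trajectory on `[0, t]`. Uniqueness allows any known trajectory,
even one defined for longer, to replace it. -/
theorem normalExp_eq (hg : ContDiff ℝ ∞ g) (hpos : ∀ z, 0 < g z) {T : ℝ}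
    {q p₀ : Coord 3} {x p : ℝ → Coord 3}
    (h : (sr g hg hpos).IsHamiltonTrajectory T q p₀ x p) {t : ℝ} (ht : t ∈ Set.Icc 0 T) :
    (sr g hg hpos).GeodesicDefined t q p₀ ∧ (sr g hg hpos).normalExp q t p₀ = x t := by
  have hsub : Set.Icc 0 t ⊆ Set.Icc 0 T := Set.Icc_subset_Icc_right ht.2
  have ht' : (sr g hg hpos).IsHamiltonTrajectory t q p₀ x p :=
    ⟨h.1, h.2.1, fun r hr => ⟨(h.2.2 r (hsub hr)).1.mono hsub, (h.2.2 r (hsub hr)).2.mono hsub⟩⟩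
  have hd : (sr g hg hpos).GeodesicDefined t q p₀ := ⟨x, p, ht'⟩
  refine ⟨hd, ?_⟩
  rw [CorankOneStructure.normalExp, dif_pos hd]
  obtain ⟨p', hp'⟩ := hd.choose_spec
  exact isHamiltonTrajectory_unique hg hpos hp' ht' (Set.right_mem_Icc.2 ht.1)

end QuasiContactExample

/-! ### Normal geodesics of the example -/

namespace QuasiContactExample

variable {g : ℝ → ℝ}

/-- The planar system for `z` and its momentum on the unit energy level, with the extra variable
`∫ dt/g`. -/
noncomputable def planarField (g : ℝ → ℝ) (y : ℝ × ℝ × ℝ) : ℝ × ℝ × ℝ :=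
  (y.2.1 * (g y.1)⁻¹, deriv g y.1 / 2 * (g y.1)⁻¹, (g y.1)⁻¹)

theorem contDiff_planarField (hg : ContDiff ℝ ∞ g) (hpos : ∀ z, 0 < g z) :
    ContDiff ℝ 1 (planarField g) := by
  have hd : ContDiff ℝ ∞ (deriv g) := (contDiff_infty_iff_deriv.1 hg).2
  have hgi : ContDiff ℝ 1 fun y : ℝ × ℝ × ℝ => (g y.1)⁻¹ :=
    ((hg.of_le (by simp)).comp contDiff_fst).inv fun y => (hpos _).ne'
  have hdg : ContDiff ℝ 1 fun y : ℝ × ℝ × ℝ => deriv g y.1 :=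
    (hd.of_le (by simp)).comp contDiff_fst
  exact ((contDiff_fst.comp contDiff_snd).mul hgi).prodMk (((hdg.div_const 2).mul hgi).prodMk hgi)

/-- The horizontal momentum `momX` as a function of the parameter `∫ dt/g`. -/
noncomputable def rotX (q p : Coord 3) (s : ℝ) : ℝ :=
  momX q p * Real.cos (p 3 * s) + momY q p * Real.sin (p 3 * s)

/-- The horizontal momentum `momY` as a function of the parameter `∫ dt/g`. -/
noncomputable def rotY (q p : Coord 3) (s : ℝ) : ℝ :=
  momY q p * Real.cos (p 3 * s) - momX q p * Real.sin (p 3 * s)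

/-- The `x`-coordinate of the geodesic as a function of `∫ dt/g`. -/
noncomputable def posX (q p : Coord 3) (s : ℝ) : ℝ := q 0 + ∫ r in 0..s, rotX q p r

/-- The `y`-coordinate of the geodesic as a function of `∫ dt/g`. -/
noncomputable def posY (q p : Coord 3) (s : ℝ) : ℝ := q 1 + ∫ r in 0..s, rotY q p r

/-- The `w`-coordinate of the geodesic as a function of `∫ dt/g`. -/
noncomputable def posW (q p : Coord 3) (s : ℝ) : ℝ :=
  q 3 + ∫ r in 0..s, (posY q p r * rotX q p r - posX q p r * rotY q p r) / 2

theorem rotX_sq_add_rotY_sq (q p : Coord 3) (s : ℝ) :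
    rotX q p s ^ 2 + rotY q p s ^ 2 = momX q p ^ 2 + momY q p ^ 2 := by
  have := Real.cos_sq_add_sin_sq (p 3 * s)
  rw [rotX, rotY]
  linear_combination (momX q p ^ 2 + momY q p ^ 2) * this

theorem hasDerivAt_rotX (q p : Coord 3) (s : ℝ) :
    HasDerivAt (rotX q p) (p 3 * rotY q p s) s := by
  have h : HasDerivAt (fun s : ℝ => p 3 * s) (p 3) s := by
    simpa using (hasDerivAt_id s).const_mul (p 3)
  exact ((h.cos.const_mul (momX q p)).add (h.sin.const_mul (momY q p))).congr_deriv
    (by rw [rotY]; ring)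

theorem hasDerivAt_rotY (q p : Coord 3) (s : ℝ) :
    HasDerivAt (rotY q p) (-(p 3 * rotX q p s)) s := by
  have h : HasDerivAt (fun s : ℝ => p 3 * s) (p 3) s := by
    simpa using (hasDerivAt_id s).const_mul (p 3)
  exact ((h.cos.const_mul (momY q p)).sub (h.sin.const_mul (momX q p))).congr_deriv
    (by rw [rotX]; ring)

theorem continuous_rotX (q : Coord 3) : Continuous fun y : Coord 3 × ℝ => rotX q y.1 y.2 := by
  unfold rotX momX momY; fun_prop

theorem continuous_rotY (q : Coord 3) : Continuous fun y : Coord 3 × ℝ => rotY q y.1 y.2 := by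
  unfold rotY momX momY; fun_prop

theorem continuous_integral_of_uncurry {f : Coord 3 → ℝ → ℝ}
    (hf : Continuous fun y : Coord 3 × ℝ => f y.1 y.2) :
    Continuous fun y : Coord 3 × ℝ => ∫ r in 0..y.2, f y.1 r := by
  refine intervalIntegral.continuous_parametric_intervalIntegral_of_continuous
    (f := fun y : Coord 3 × ℝ => f y.1) ?_ continuous_snd
  exact hf.comp (by fun_prop : Continuous fun y : (Coord 3 × ℝ) × ℝ => (y.1.1, y.2))

theorem continuousOn_of_uncurry {f : Coord 3 → ℝ → ℝ} {s : Coord 3 → ℝ} {S : Set (Coord 3)}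
    (hf : Continuous fun y : Coord 3 × ℝ => f y.1 y.2) (hs : ContinuousOn s S) :
    ContinuousOn (fun p => f p (s p)) S :=
  hf.comp_continuousOn (continuousOn_id.prodMk hs)

theorem continuous_posX (q : Coord 3) : Continuous fun y : Coord 3 × ℝ => posX q y.1 y.2 :=
  continuous_const.add (continuous_integral_of_uncurry (continuous_rotX q))

theorem continuous_posY (q : Coord 3) : Continuous fun y : Coord 3 × ℝ => posY q y.1 y.2 :=
  continuous_const.add (continuous_integral_of_uncurry (continuous_rotY q))

theorem continuous_posW_integrand (q : Coord 3) : Continuous fun y : Coord 3 × ℝ =>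
    (posY q y.1 y.2 * rotX q y.1 y.2 - posX q y.1 y.2 * rotY q y.1 y.2) / 2 :=
  (((continuous_posY q).mul (continuous_rotX q)).sub
    ((continuous_posX q).mul (continuous_rotY q))).div_const 2

theorem continuous_posW (q : Coord 3) : Continuous fun y : Coord 3 × ℝ => posW q y.1 y.2 :=
  continuous_const.add (continuous_integral_of_uncurry
    (f := fun p r => (posY q p r * rotX q p r - posX q p r * rotY q p r) / 2)
    (continuous_posW_integrand q))

theorem hasDerivAt_const_add_integral {f : ℝ → ℝ} (hf : Continuous f) (c s : ℝ) :
    HasDerivAt (fun s => c + ∫ r in 0..s, f r) (f s) s :=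
  (hf.integral_hasStrictDerivAt 0 s).hasDerivAt.const_add c

theorem abs_integral_le {f : ℝ → ℝ} {C M s : ℝ} (hC : 0 ≤ C) (hf : ∀ r, |r| ≤ M → |f r| ≤ C)
    (hs : |s| ≤ M) : |∫ r in 0..s, f r| ≤ C * M := by
  have h := intervalIntegral.norm_integral_le_of_norm_le_const (a := 0) (b := s) (f := f) (C := C)
    fun r hr => hf r (by
      have := Set.abs_sub_left_of_mem_uIcc (Set.uIoc_subset_uIcc hr)
      simp only [sub_zero] at this
      exact this.trans hs)
  rw [sub_zero, Real.norm_eq_abs] at h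
  exact h.trans (by gcongr)

theorem abs_rot_le (hg : ContDiff ℝ ∞ g) (hpos : ∀ z, 0 < g z) {q p : Coord 3}
    (hp : p ∈ (sr g hg hpos).unitCovectors q) (r : ℝ) :
    |rotX q p r| ≤ √(g (q 2)) ∧ |rotY q p r| ≤ √(g (q 2)) := by
  rw [mem_unitCovectors_iff] at hp
  have := rotX_sq_add_rotY_sq q p r
  constructor <;> apply Real.abs_le_sqrt <;>
    nlinarith [sq_nonneg (rotX q p r), sq_nonneg (rotY q p r), sq_nonneg (p 2)]

theorem abs_pos_le (hg : ContDiff ℝ ∞ g) (hpos : ∀ z, 0 < g z) {q p : Coord 3}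
    (hp : p ∈ (sr g hg hpos).unitCovectors q) {s M : ℝ} (hs : |s| ≤ M) :
    |posX q p s| ≤ |q 0| + √(g (q 2)) * M ∧ |posY q p s| ≤ |q 1| + √(g (q 2)) * M :=
  ⟨(abs_add_le _ _).trans (add_le_add le_rfl (abs_integral_le (Real.sqrt_nonneg _)
      (fun r _ => (abs_rot_le hg hpos hp r).1) hs)),
    (abs_add_le _ _).trans (add_le_add le_rfl (abs_integral_le (Real.sqrt_nonneg _)
      (fun r _ => (abs_rot_le hg hpos hp r).2) hs))⟩

theorem abs_posW_le (hg : ContDiff ℝ ∞ g) (hpos : ∀ z, 0 < g z) {q p : Coord 3}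
    (hp : p ∈ (sr g hg hpos).unitCovectors q) {s M : ℝ} (hs : |s| ≤ M) :
    |posW q p s| ≤ |q 3| +
      (|q 0| + |q 1| + √(g (q 2)) * M + √(g (q 2)) * M) * √(g (q 2)) * M := by
  have hM : 0 ≤ M := (abs_nonneg _).trans hs
  have hS := Real.sqrt_nonneg (g (q 2))
  refine (abs_add_le _ _).trans (add_le_add le_rfl (abs_integral_le (by positivity) ?_ hs))
  intro r hr
  obtain ⟨h1, h2⟩ := abs_rot_le hg hpos hp r
  obtain ⟨h3, h4⟩ := abs_pos_le hg hpos hp hr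
  have h5 : |posY q p r * rotX q p r| ≤ (|q 1| + √(g (q 2)) * M) * √(g (q 2)) := by
    rw [abs_mul]; gcongr
  have h6 : |posX q p r * rotY q p r| ≤ (|q 0| + √(g (q 2)) * M) * √(g (q 2)) := by
    rw [abs_mul]; gcongr
  have h7 := abs_sub (posY q p r * rotX q p r) (posX q p r * rotY q p r)
  have h8 := abs_nonneg (posY q p r * rotX q p r - posX q p r * rotY q p r)
  rw [abs_div, abs_two]
  linarith

set_option maxHeartbeats 400000 in
/-- Normal geodesics with initial covectors on the whole (noncompact) unit cylinder at `q` exist for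
a common time, stay in a bounded set, and depend continuously on the initial covector. -/
theorem exists_unit_geodesics (hg : ContDiff ℝ ∞ g) (hpos : ∀ z, 0 < g z) (q : Coord 3) :
    ∃ T > 0, ∃ R : ℝ, ∃ x p : Coord 3 → ℝ → Coord 3,
      (∀ p₀ ∈ (sr g hg hpos).unitCovectors q,
        (sr g hg hpos).IsHamiltonTrajectory T q p₀ (x p₀) (p p₀) ∧
        ∀ t ∈ Set.Icc 0 T, ‖x p₀ t‖ ≤ R ∧ p p₀ t 3 = p₀ 3 ∧
          p p₀ t ∈ (sr g hg hpos).unitCovectors (x p₀ t)) ∧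
      ∀ t ∈ Set.Icc 0 T, ContinuousOn (fun p₀ => x p₀ t) ((sr g hg hpos).unitCovectors q) := by
  have hG := hpos (q 2)
  set G := g (q 2) with hGdef
  -- On the unit level `|p_z| ≤ √g`, so the initial data of the planar system range over a compact
  -- ball even though the cylinder is unbounded. This makes `T`, and the bound `M` below, uniform.
  obtain ⟨T, hT, α, hα, hαc⟩ := (contDiff_planarField hg hpos).exists_flow_closedBall (q 2, 0, 0)
    (Real.sqrt_nonneg G)
  set init : Coord 3 → ℝ × ℝ × ℝ := fun p₀ => (q 2, p₀ 2, 0) with hinit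
  have hinit_mem : ∀ p₀ ∈ (sr g hg hpos).unitCovectors q,
      init p₀ ∈ Metric.closedBall (q 2, (0 : ℝ), (0 : ℝ)) (√G) := by
    intro p₀ hp₀
    rw [mem_unitCovectors_iff] at hp₀
    simp only [hinit, mem_closedBall_iff_norm, Prod.mk_sub_mk, sub_self, sub_zero, Prod.norm_mk,
      norm_zero, Real.norm_eq_abs]
    have : |p₀ 2| ≤ √G := by
      apply Real.abs_le_sqrt
      nlinarith [sq_nonneg (momX q p₀), sq_nonneg (momY q p₀)]
    exact max_le (Real.sqrt_nonneg G) (max_le this (Real.sqrt_nonneg G))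
  obtain ⟨M, hM⟩ := (((isCompact_closedBall _ _).prod isCompact_Icc).image_of_continuousOn
    hαc).isBounded.exists_norm_le
  have hM' : ∀ p₀ ∈ (sr g hg hpos).unitCovectors q, ∀ t ∈ Set.Icc 0 T, ‖α (init p₀, t)‖ ≤ M :=
    fun p₀ hp₀ t ht => hM _ ⟨_, ⟨hinit_mem p₀ hp₀, ht⟩, rfl⟩
  set s : Coord 3 → ℝ → ℝ := fun p₀ t => (α (init p₀, t)).2.2 with hs
  set z : Coord 3 → ℝ → ℝ := fun p₀ t => (α (init p₀, t)).1 with hz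
  set m : Coord 3 → ℝ → ℝ := fun p₀ t => (α (init p₀, t)).2.1 with hm
  set x : Coord 3 → ℝ → Coord 3 := fun p₀ t =>
    ![posX q p₀ (s p₀ t), posY q p₀ (s p₀ t), z p₀ t, posW q p₀ (s p₀ t)] with hx
  -- The covector is chosen so that its momenta along `x` are the rotated ones `rotX` and `rotY`;
  -- its last component is constant.
  set p : Coord 3 → ℝ → Coord 3 := fun p₀ t =>
    ![rotX q p₀ (s p₀ t) - posY q p₀ (s p₀ t) / 2 * p₀ 3,
      rotY q p₀ (s p₀ t) + posX q p₀ (s p₀ t) / 2 * p₀ 3, m p₀ t, p₀ 3] with hp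
  have hmX : ∀ p₀ t, momX (x p₀ t) (p p₀ t) = rotX q p₀ (s p₀ t) := by
    intro p₀ t; simp [momX, hx, hp]
  have hmY : ∀ p₀ t, momY (x p₀ t) (p p₀ t) = rotY q p₀ (s p₀ t) := by
    intro p₀ t; simp [momY, hx, hp]
  have hder : ∀ p₀ ∈ (sr g hg hpos).unitCovectors q, ∀ t ∈ Set.Icc 0 T,
      HasDerivWithinAt (z p₀) (m p₀ t * (g (z p₀ t))⁻¹) (Set.Icc 0 T) t ∧
      HasDerivWithinAt (m p₀) (deriv g (z p₀ t) / 2 * (g (z p₀ t))⁻¹) (Set.Icc 0 T) t ∧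
      HasDerivWithinAt (s p₀) (g (z p₀ t))⁻¹ (Set.Icc 0 T) t := by
    intro p₀ hp₀ t ht
    have h := (hα _ (hinit_mem p₀ hp₀)).2 t ht
    have h1 := (hasFDerivAt_fst (𝕜 := ℝ) (p := α (init p₀, t))).comp_hasDerivWithinAt t h
    have h2 := (hasFDerivAt_snd (𝕜 := ℝ) (p := α (init p₀, t))).comp_hasDerivWithinAt t h
    have h3 := (hasFDerivAt_fst (𝕜 := ℝ) (p := (α (init p₀, t)).2)).comp_hasDerivWithinAt t h2
    have h4 := (hasFDerivAt_snd (𝕜 := ℝ) (p := (α (init p₀, t)).2)).comp_hasDerivWithinAt t h2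
    exact ⟨h1, h3, h4⟩
  have hs0 : ∀ p₀ ∈ (sr g hg hpos).unitCovectors q, s p₀ 0 = 0 ∧ z p₀ 0 = q 2 ∧ m p₀ 0 = p₀ 2 := by
    intro p₀ hp₀
    have h := (hα _ (hinit_mem p₀ hp₀)).1
    exact ⟨congrArg (fun y => y.2.2) h, congrArg (fun y => y.1) h, congrArg (fun y => y.2.1) h⟩
  have henergy : ∀ p₀ ∈ (sr g hg hpos).unitCovectors q, ∀ t ∈ Set.Icc 0 T,
      p p₀ t ∈ (sr g hg hpos).unitCovectors (x p₀ t) := by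
    intro p₀ hp₀ t ht
    -- The planar system conserves `m² - g(z)` and rotation conserves the other two squared momenta.
    -- Together these keep the curve on the unit level.
    have hd : ∀ t ∈ Set.Icc 0 T,
        HasDerivWithinAt (fun t => m p₀ t ^ 2 - g (z p₀ t)) 0 (Set.Icc 0 T) t := by
      intro t ht
      obtain ⟨h1, h2, -⟩ := hder p₀ hp₀ t ht
      have h3 := (differentiable_of_contDiff_top hg (z p₀ t)).hasDerivAt.comp_hasDerivWithinAt t h1
      exact ((h2.pow 2).sub h3).congr_deriv (by simp; ring)
    have hconst := constant_of_has_deriv_right_zero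
      (fun t ht => (hd t ht).continuousWithinAt)
      (fun t ht => (hd t (Set.Ico_subset_Icc_self ht)).mono_of_mem_nhdsWithin
        (mem_of_superset (Icc_mem_nhdsGE ht.2) (Set.Icc_subset_Icc_left ht.1))) t ht
    obtain ⟨-, h1, h2⟩ := hs0 p₀ hp₀
    rw [h1, h2] at hconst
    rw [mem_unitCovectors_iff] at hp₀ ⊢
    rw [hmX, hmY, rotX_sq_add_rotY_sq]
    change _ + m p₀ t ^ 2 = g (z p₀ t)
    linarith
  refine ⟨T, hT, |q 0| + |q 1| + |q 3| + M + √G * M + √G * M +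
    (|q 0| + |q 1| + √G * M + √G * M) * √G * M, x, p, fun p₀ hp₀ => ⟨?_, fun t ht =>
      ⟨?_, rfl, henergy p₀ hp₀ t ht⟩⟩, fun t ht => ?_⟩
  · rw [isHamiltonTrajectory_iff]
    obtain ⟨h0, h1, h2⟩ := hs0 p₀ hp₀
    refine ⟨?_, ?_, fun t ht => ?_⟩
    · ext j
      fin_cases j <;> simp [hx, h0, h1, posX, posY, posW]
    · ext j
      fin_cases j <;> simp [hp, h0, h2, posX, posY, rotX, rotY, momX, momY]
    · obtain ⟨dz, dm, ds⟩ := hder p₀ hp₀ t ht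
      have dX := (hasDerivAt_const_add_integral (f := rotX q p₀)
        ((continuous_rotX q).comp (by fun_prop : Continuous fun r : ℝ => (p₀, r))) (q 0)
        (s p₀ t)).comp_hasDerivWithinAt t ds
      have dY := (hasDerivAt_const_add_integral (f := rotY q p₀)
        ((continuous_rotY q).comp (by fun_prop : Continuous fun r : ℝ => (p₀, r))) (q 1)
        (s p₀ t)).comp_hasDerivWithinAt t ds
      have dW := (hasDerivAt_const_add_integral
        ((continuous_posW_integrand q).comp (by fun_prop : Continuous fun r : ℝ => (p₀, r))) (q 3)
        (s p₀ t)).comp_hasDerivWithinAt t ds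
      have dR := (hasDerivAt_rotX q p₀ (s p₀ t)).comp_hasDerivWithinAt t ds
      have dS := (hasDerivAt_rotY q p₀ (s p₀ t)).comp_hasDerivWithinAt t ds
      have he := (mem_unitCovectors_iff hg hpos _ _).1 (henergy p₀ hp₀ t ht)
      constructor
      · refine hasDerivWithinAt_pi.2 fun j => ?_
        fin_cases j
        · refine dX.congr_deriv ?_
          change _ = (g (z p₀ t))⁻¹ * momX (x p₀ t) (p p₀ t)
          rw [hmX, mul_comm]
        · refine dY.congr_deriv ?_
          change _ = (g (z p₀ t))⁻¹ * momY (x p₀ t) (p p₀ t)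
          rw [hmY, mul_comm]
        · exact dz.congr_deriv (mul_comm _ _)
        · refine dW.congr_deriv ?_
          change _ = (g (z p₀ t))⁻¹ * ((posY q p₀ (s p₀ t) * momX (x p₀ t) (p p₀ t)
            - posX q p₀ (s p₀ t) * momY (x p₀ t) (p p₀ t)) / 2)
          rw [hmX, hmY, mul_comm]
          rfl
      · refine hasDerivWithinAt_pi.2 fun j => ?_
        fin_cases j
        · refine (dR.sub ((dY.div_const 2).mul_const (p₀ 3))).congr_deriv ?_
          change _ = momY (x p₀ t) (p p₀ t) * p₀ 3 / 2 * (g (z p₀ t))⁻¹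
          rw [hmY]
          ring
        · refine (dS.add ((dX.div_const 2).mul_const (p₀ 3))).congr_deriv ?_
          change _ = -(momX (x p₀ t) (p p₀ t) * p₀ 3) / 2 * (g (z p₀ t))⁻¹
          rw [hmX]
          ring
        -- The true force on `p_z` contains the sum of the squared momenta. Conservation of energy
        -- replaces it by `g(z)`, which turns it into the planar equation.
        · refine dm.congr_deriv ?_
          change _ = deriv g (z p₀ t) / 2 * (g (z p₀ t))⁻¹ ^ 2 * (momX (x p₀ t) (p p₀ t) ^ 2 +
            momY (x p₀ t) (p p₀ t) ^ 2 + p p₀ t 2 ^ 2)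
          rw [he]
          change _ = deriv g (z p₀ t) / 2 * (g (z p₀ t))⁻¹ ^ 2 * g (z p₀ t)
          have := (hpos (z p₀ t)).ne'
          field_simp
        · exact hasDerivWithinAt_const _ _ _
  · have hMt := hM' p₀ hp₀ t ht
    have hM0 : 0 ≤ M := (norm_nonneg _).trans hMt
    have hzM : |z p₀ t| ≤ M := (norm_fst_le _).trans hMt
    have hsM : |s p₀ t| ≤ M := ((norm_snd_le _).trans (norm_snd_le _)).trans hMt
    obtain ⟨bX, bY⟩ := abs_pos_le hg hpos hp₀ hsM
    have bW := abs_posW_le hg hpos hp₀ hsM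
    rw [← hGdef] at bX bY bW
    have n0 := abs_nonneg (q 0)
    have n1 := abs_nonneg (q 1)
    have n3 := abs_nonneg (q 3)
    have n4 : 0 ≤ √G * M := by positivity
    have n5 : 0 ≤ (|q 0| + |q 1| + √G * M + √G * M) * √G * M := by positivity
    refine (pi_norm_le_iff_of_nonneg (by positivity)).2 fun j => ?_
    fin_cases j
    · exact (show |posX q p₀ (s p₀ t)| ≤ _ by linarith)
    · exact (show |posY q p₀ (s p₀ t)| ≤ _ by linarith)
    · exact (show |z p₀ t| ≤ _ by linarith)
    · exact (show |posW q p₀ (s p₀ t)| ≤ _ by linarith)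
  · have hαt : ContinuousOn (fun p₀ => α (init p₀, t)) ((sr g hg hpos).unitCovectors q) :=
      hαc.comp (by fun_prop) fun p₀ hp₀ => ⟨hinit_mem p₀ hp₀, ht⟩
    have hz' : ContinuousOn (fun p₀ => z p₀ t) ((sr g hg hpos).unitCovectors q) :=
      hαt.fst
    have hs' : ContinuousOn (fun p₀ => s p₀ t) ((sr g hg hpos).unitCovectors q) :=
      hαt.snd.snd
    have hX : ContinuousOn (fun p₀ => posX q p₀ (s p₀ t)) ((sr g hg hpos).unitCovectors q) :=
      continuousOn_of_uncurry (f := posX q) (continuous_posX q) hs'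
    have hY : ContinuousOn (fun p₀ => posY q p₀ (s p₀ t)) ((sr g hg hpos).unitCovectors q) :=
      continuousOn_of_uncurry (f := posY q) (continuous_posY q) hs'
    have hW : ContinuousOn (fun p₀ => posW q p₀ (s p₀ t)) ((sr g hg hpos).unitCovectors q) :=
      continuousOn_of_uncurry (f := posW q) (continuous_posW q) hs'
    refine continuousOn_pi.2 fun j => ?_
    fin_cases j
    · exact hX
    · exact hY
    · exact hz'
    · exact hW

end QuasiContactExample

/-! ### Second order expansion along normal geodesics -/

theorem abs_sub_le_of_hasDerivWithinAt {f f' : ℝ → ℝ} {t C : ℝ} (ht : 0 ≤ t)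
    (hf : ∀ r ∈ Set.Icc 0 t, HasDerivWithinAt f (f' r) (Set.Icc 0 t) r)
    (hb : ∀ r ∈ Set.Icc 0 t, |f' r| ≤ C) : |f t - f 0| ≤ C * t := by
  have := (convex_Icc (0 : ℝ) t).norm_image_sub_le_of_norm_hasDerivWithin_le hf hb
    (Set.left_mem_Icc.2 ht) (Set.right_mem_Icc.2 ht)
  simpa [abs_of_nonneg ht] using this

/-- Two applications of the mean value inequality give `C` instead of the sharp `C / 2`; only a
dominating function is needed. -/
theorem abs_taylor_le {f f₁ f₂ : ℝ → ℝ} {T C : ℝ}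
    (h₁ : ∀ r ∈ Set.Icc 0 T, HasDerivWithinAt f (f₁ r) (Set.Icc 0 T) r)
    (h₂ : ∀ r ∈ Set.Icc 0 T, HasDerivWithinAt f₁ (f₂ r) (Set.Icc 0 T) r)
    (hC : ∀ r ∈ Set.Icc 0 T, |f₂ r| ≤ C) {t : ℝ} (ht : t ∈ Set.Icc 0 T) :
    |f t - f 0 - t * f₁ 0| ≤ C * t ^ 2 := by
  have hC0 : 0 ≤ C := (abs_nonneg _).trans (hC t ht)
  have sub : ∀ r ∈ Set.Icc 0 t, Set.Icc 0 r ⊆ Set.Icc 0 T := fun r hr =>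
    Set.Icc_subset_Icc_right (hr.2.trans ht.2)
  have hb : ∀ r ∈ Set.Icc 0 t, |f₁ r - 1 * f₁ 0| ≤ C * t := fun r hr => by
    rw [one_mul]
    exact (abs_sub_le_of_hasDerivWithinAt hr.1
      (fun s hs => (h₂ s (sub r hr hs)).mono (sub r hr)) (fun s hs => hC s (sub r hr hs))).trans
        (by gcongr; exact hr.2)
  have hst := sub t (Set.right_mem_Icc.2 ht.1)
  have := abs_sub_le_of_hasDerivWithinAt (f := fun r => f r - r * f₁ 0) ht.1
    (fun r hr => ((h₁ r (hst hr)).mono hst).sub ((hasDerivWithinAt_id r _).mul_const (f₁ 0))) hb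
  calc |f t - f 0 - t * f₁ 0| = |f t - t * f₁ 0 - (f 0 - 0 * f₁ 0)| := by congr 1; ring
    _ ≤ C * t * t := this
    _ = C * t ^ 2 := by ring

theorem tendsto_taylor {f f₁ : ℝ → ℝ} {T A : ℝ} (hT : 0 < T)
    (h₁ : ∀ r ∈ Set.Icc 0 T, HasDerivWithinAt f (f₁ r) (Set.Icc 0 T) r)
    (h₂ : HasDerivWithinAt f₁ A (Set.Icc 0 T) 0) :
    Tendsto (fun t => (f t - f 0 - t * f₁ 0) / t ^ 2) (𝓝[>] 0) (𝓝 (A / 2)) := by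
  rw [Metric.tendsto_nhds]
  intro ε hε
  have h := h₂.isLittleO.def (half_pos hε)
  rw [eventually_nhdsWithin_iff, Metric.eventually_nhds_iff] at h
  obtain ⟨δ, hδ, h⟩ := h
  have hmem : Set.Ioo (0 : ℝ) (min δ T) ∈ 𝓝[>] (0 : ℝ) := Ioo_mem_nhdsGT (lt_min hδ hT)
  filter_upwards [hmem] with t ht
  have htδ := ht.2.trans_le (min_le_left _ _)
  have htT := ht.2.trans_le (min_le_right _ _)
  have hst : Set.Icc 0 t ⊆ Set.Icc 0 T := Set.Icc_subset_Icc_right htT.le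
  have hb : ∀ r ∈ Set.Icc 0 t, |f₁ r - 1 * f₁ 0 - A / 2 * (2 * r)| ≤ ε / 2 * t := by
    intro r hr
    have := h (y := r) (by simpa [abs_of_nonneg hr.1] using hr.2.trans_lt htδ) (hst hr)
    simp only [sub_zero, smul_eq_mul, Real.norm_eq_abs, abs_of_nonneg hr.1] at this
    calc |f₁ r - 1 * f₁ 0 - A / 2 * (2 * r)| = |f₁ r - f₁ 0 - r * A| := by congr 1; ring
      _ ≤ ε / 2 * r := this
      _ ≤ ε / 2 * t := by gcongr; exact hr.2
  -- Subtracting the full quadratic polynomial leaves a function whose derivative is `o(r)`, because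
  -- `f₁` is differentiable at `0`. Integrating this bound gives the `o(t²)` remainder.
  have := abs_sub_le_of_hasDerivWithinAt (f := fun r => f r - r * f₁ 0 - A / 2 * r ^ 2) ht.1.le
    (fun r hr => (((h₁ r (hst hr)).mono hst).sub
      ((hasDerivWithinAt_id r _).mul_const (f₁ 0))).sub
        ((((hasDerivAt_pow 2 r).congr_deriv (by simp :
          _ = 2 * r)).hasDerivWithinAt).const_mul (A / 2))) hb
  have ht2 : 0 < t ^ 2 := pow_pos ht.1 2
  rw [Real.dist_eq]
  have e : (f t - f 0 - t * f₁ 0) / t ^ 2 - A / 2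
      = (f t - t * f₁ 0 - A / 2 * t ^ 2 - (f 0 - 0 * f₁ 0 - A / 2 * 0 ^ 2)) / t ^ 2 := by
    have := ht.1.ne'
    field_simp; ring
  rw [e, abs_div, abs_of_pos ht2, div_lt_iff₀ ht2]
  calc _ ≤ ε / 2 * t * t := this
    _ < ε * t ^ 2 := by nlinarith

/-! ### Acceleration and the uniform expansion on the unit cylinder -/

namespace QuasiContactExample

variable {g : ℝ → ℝ}

/-- The values of `√g X`, `√g Y`, `√g Z` on a covector. -/
noncomputable def momenta (q p : Coord 3) : Fin 3 → ℝ := ![momX q p, momY q p, p 2]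

/-- The velocity as a function of the momenta. -/
noncomputable def horizontalVec (g : ℝ → ℝ) (q : Coord 3) (u : Fin 3 → ℝ) : Coord 3 :=
  (g (q 2))⁻¹ • ![u 0, u 1, u 2, (q 1 * u 0 - q 0 * u 1) / 2]

/-- The part of the acceleration that is proportional to the vertical momentum. -/
noncomputable def magneticVec (g : ℝ → ℝ) (q : Coord 3) (u : Fin 3 → ℝ) : Coord 3 :=
  (g (q 2))⁻¹ ^ 2 • ![u 1, -u 0, 0, (q 1 * u 1 + q 0 * u 0) / 2]

/-- The part of the acceleration that does not involve the vertical momentum. -/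
noncomputable def conformalVec (g : ℝ → ℝ) (q : Coord 3) (u : Fin 3 → ℝ) : Coord 3 :=
  (-(deriv g (q 2) * u 2 * (g (q 2))⁻¹ ^ 2)) • horizontalVec g q u
    + (deriv g (q 2) / 2 * (g (q 2))⁻¹ ^ 2) • ![0, 0, 1, 0]

theorem velocity_eq (g : ℝ → ℝ) (q p : Coord 3) :
    velocity g q p = horizontalVec g q (momenta q p) := rfl

/-- The acceleration of a unit speed normal geodesic. -/
noncomputable def acceleration (g : ℝ → ℝ) (q p : Coord 3) : Coord 3 :=
  p 3 • magneticVec g q (momenta q p) + conformalVec g q (momenta q p)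

/-- The momenta `(momX, momY)` turn at the rate `p 3 / g` and `p 3` is constant, which makes the
acceleration affine in `p 3`. The unit energy hypothesis simplifies the derivative of `p_z`. -/
theorem hasDerivWithinAt_velocity (hg : ContDiff ℝ ∞ g) (hpos : ∀ z, 0 < g z) {T : ℝ}
    {q p₀ : Coord 3} {x p : ℝ → Coord 3}
    (h : (sr g hg hpos).IsHamiltonTrajectory T q p₀ x p) {t : ℝ} (ht : t ∈ Set.Icc 0 T)
    (hu : p t ∈ (sr g hg hpos).unitCovectors (x t)) :
    HasDerivWithinAt (fun t => velocity g (x t) (p t)) (acceleration g (x t) (p t))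
      (Set.Icc 0 T) t := by
  rw [isHamiltonTrajectory_iff] at h
  rw [mem_unitCovectors_iff] at hu
  obtain ⟨hx, hp⟩ := h.2.2 t ht
  have dx := hasDerivWithinAt_pi.1 hx
  have dp := hasDerivWithinAt_pi.1 hp
  have hG := hpos (x t 2)
  have dX : HasDerivWithinAt (fun t => momX (x t) (p t))
      (momY (x t) (p t) * p t 3 * (g (x t 2))⁻¹) (Set.Icc 0 T) t := by
    refine ((dp 0).add (((dx 1).div_const 2).mul (dp 3))).congr_deriv ?_
    simp [velocity, force]
    ring
  have dY : HasDerivWithinAt (fun t => momY (x t) (p t))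
      (-(momX (x t) (p t) * p t 3 * (g (x t 2))⁻¹)) (Set.Icc 0 T) t := by
    refine ((dp 1).sub (((dx 0).div_const 2).mul (dp 3))).congr_deriv ?_
    simp [velocity, force]
    ring
  have dZ : HasDerivWithinAt (fun t => p t 2)
      (deriv g (x t 2) / 2 * (g (x t 2))⁻¹) (Set.Icc 0 T) t := by
    refine (dp 2).congr_deriv ?_
    simp only [force, hu]
    change deriv g (x t 2) / 2 * (g (x t 2))⁻¹ ^ 2 * g (x t 2) = _
    field_simp
  have dG : HasDerivWithinAt (fun t => (g (x t 2))⁻¹)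
      (-(deriv g (x t 2) * (p t 2 * (g (x t 2))⁻¹)) / g (x t 2) ^ 2) (Set.Icc 0 T) t := by
    refine (((differentiable_of_contDiff_top hg (x t 2)).hasDerivAt.comp_hasDerivWithinAt t
      (dx 2)).inv hG.ne').congr_deriv ?_
    simp [velocity]
    ring
  refine hasDerivWithinAt_pi.2 fun j => ?_
  fin_cases j
  · refine (dG.mul dX).congr_deriv ?_
    simp [acceleration, magneticVec, conformalVec, horizontalVec, momenta]
    field_simp
    ring
  · refine (dG.mul dY).congr_deriv ?_
    simp [acceleration, magneticVec, conformalVec, horizontalVec, momenta]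
    field_simp
    ring
  · refine (dG.mul dZ).congr_deriv ?_
    simp [acceleration, magneticVec, conformalVec, horizontalVec, momenta]
    field_simp
  · refine (dG.mul ((((dx 1).mul dX).sub ((dx 0).mul dY)).div_const 2)).congr_deriv ?_
    simp [acceleration, magneticVec, conformalVec, horizontalVec, momenta, velocity]
    field_simp
    ring

theorem continuous_horizontalVec (hg : ContDiff ℝ ∞ g) (hpos : ∀ z, 0 < g z) :
    Continuous fun y : Coord 3 × (Fin 3 → ℝ) => horizontalVec g y.1 y.2 := by
  have hgi : Continuous fun y : Coord 3 × (Fin 3 → ℝ) => (g (y.1 2))⁻¹ :=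
    (hg.continuous.comp (by fun_prop)).inv₀ fun y => (hpos _).ne'
  refine hgi.smul (continuous_pi fun j => ?_)
  fin_cases j <;> simp <;> fun_prop

theorem continuous_magneticVec (hg : ContDiff ℝ ∞ g) (hpos : ∀ z, 0 < g z) :
    Continuous fun y : Coord 3 × (Fin 3 → ℝ) => magneticVec g y.1 y.2 := by
  have hgi : Continuous fun y : Coord 3 × (Fin 3 → ℝ) => (g (y.1 2))⁻¹ :=
    (hg.continuous.comp (by fun_prop)).inv₀ fun y => (hpos _).ne'
  refine (hgi.pow 2).smul (continuous_pi fun j => ?_)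
  fin_cases j <;> simp <;> fun_prop

theorem continuous_conformalVec (hg : ContDiff ℝ ∞ g) (hpos : ∀ z, 0 < g z) :
    Continuous fun y : Coord 3 × (Fin 3 → ℝ) => conformalVec g y.1 y.2 := by
  have hgi : Continuous fun y : Coord 3 × (Fin 3 → ℝ) => (g (y.1 2))⁻¹ :=
    (hg.continuous.comp (by fun_prop)).inv₀ fun y => (hpos _).ne'
  have hd : ContDiff ℝ ∞ (deriv g) := (contDiff_infty_iff_deriv.1 hg).2
  have hdg : Continuous fun y : Coord 3 × (Fin 3 → ℝ) => deriv g (y.1 2) :=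
    hd.continuous.comp (by fun_prop)
  have hu : Continuous fun y : Coord 3 × (Fin 3 → ℝ) => y.2 2 := by fun_prop
  exact ((((hdg.mul hu).mul (hgi.pow 2)).neg).smul (continuous_horizontalVec hg hpos)).add
    (((hdg.div_const 2).mul (hgi.pow 2)).smul continuous_const)

theorem continuous_momenta (q : Coord 3) : Continuous (momenta q) := by
  refine continuous_pi fun j => ?_
  fin_cases j <;> simp [momenta, momX, momY] <;> fun_prop

/-- On a bounded set of base points, velocity and acceleration of unit speed normal geodesics are
bounded, up to the linear dependence on the vertical momentum. -/
theorem exists_velocity_acceleration_bound (hg : ContDiff ℝ ∞ g) (hpos : ∀ z, 0 < g z) (R : ℝ) :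
    ∃ C, ∀ q p, ‖q‖ ≤ R → p ∈ (sr g hg hpos).unitCovectors q →
      ‖velocity g q p‖ ≤ C ∧ ‖acceleration g q p‖ ≤ C * (1 + |p 3|) := by
  have hgc : Continuous fun q : Coord 3 => √(g (q 2)) :=
    (hg.continuous.comp (by fun_prop)).sqrt
  obtain ⟨U, hU⟩ := (isCompact_closedBall (0 : Coord 3) R).exists_bound_of_continuousOn
    hgc.continuousOn
  have hK := (isCompact_closedBall (0 : Coord 3) R).prod
    (isCompact_closedBall (0 : Fin 3 → ℝ) U)
  obtain ⟨C₁, h₁⟩ := hK.exists_bound_of_continuousOn (continuous_horizontalVec hg hpos).continuousOn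
  obtain ⟨C₂, h₂⟩ := hK.exists_bound_of_continuousOn (continuous_magneticVec hg hpos).continuousOn
  obtain ⟨C₃, h₃⟩ := hK.exists_bound_of_continuousOn (continuous_conformalVec hg hpos).continuousOn
  refine ⟨max C₁ (max C₂ C₃), fun q p hq hp => ?_⟩
  have hqU := hU q (by simpa using hq)
  rw [Real.norm_eq_abs, abs_of_nonneg (Real.sqrt_nonneg _)] at hqU
  rw [mem_unitCovectors_iff] at hp
  have hmem : (q, momenta q p) ∈ Metric.closedBall (0 : Coord 3) R ×ˢ
      Metric.closedBall (0 : Fin 3 → ℝ) U := by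
    refine ⟨by simpa using hq, ?_⟩
    rw [mem_closedBall_zero_iff, pi_norm_le_iff_of_nonneg ((Real.sqrt_nonneg _).trans hqU)]
    intro j
    refine le_trans (Real.abs_le_sqrt ?_) hqU
    fin_cases j <;> simp [momenta] <;>
      nlinarith [sq_nonneg (momX q p), sq_nonneg (momY q p), sq_nonneg (p 2)]
  have b₁ := (h₁ _ hmem).trans (le_max_left C₁ (max C₂ C₃))
  have b₂ := (h₂ _ hmem).trans ((le_max_left C₂ C₃).trans (le_max_right C₁ _))
  have b₃ := (h₃ _ hmem).trans ((le_max_right C₂ C₃).trans (le_max_right C₁ _))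
  refine ⟨b₁, (norm_add_le _ _).trans ?_⟩
  rw [norm_smul, Real.norm_eq_abs, mul_add, mul_one, add_comm]
  have := mul_le_mul_of_nonneg_left b₂ (abs_nonneg (p 3))
  linarith

/-- Half of `secondVariation` is the second order term of `φ` along a normal geodesic. -/
noncomputable def secondVariation (g : ℝ → ℝ) (φ : Coord 3 → ℝ) (q p : Coord 3) : ℝ :=
  fderiv ℝ (fderiv ℝ φ) q (velocity g q p) (velocity g q p) + fderiv ℝ φ q (acceleration g q p)

/-- The positions stay in a fixed ball, where the derivatives of `φ`, the velocity and both
coefficients of the acceleration are bounded. As `p 3` is conserved, the second derivative along the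
geodesic is at most a constant times `1 + |p 3|`, with the initial `p 3`. -/
theorem exists_normalExp_expansion (hg : ContDiff ℝ ∞ g) (hpos : ∀ z, 0 < g z) (q : Coord 3) :
    ∃ T > 0, (∀ t ∈ Set.Icc 0 T, (∀ p ∈ (sr g hg hpos).unitCovectors q,
        (sr g hg hpos).GeodesicDefined t q p) ∧
        ContinuousOn (fun p => (sr g hg hpos).normalExp q t p) ((sr g hg hpos).unitCovectors q)) ∧
      ∀ φ : Coord 3 → ℝ, ContDiff ℝ ∞ φ → ∃ C, ∀ p ∈ (sr g hg hpos).unitCovectors q,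
        (∀ t ∈ Set.Icc 0 T, |φ ((sr g hg hpos).normalExp q t p) - φ q
          - t * fderiv ℝ φ q (velocity g q p)| ≤ C * (1 + |p 3|) * t ^ 2) ∧
        Tendsto (fun t => (φ ((sr g hg hpos).normalExp q t p) - φ q
          - t * fderiv ℝ φ q (velocity g q p)) / t ^ 2) (𝓝[>] 0)
          (𝓝 (secondVariation g φ q p / 2)) := by
  obtain ⟨T, hT, R, x, p, h, hc⟩ := exists_unit_geodesics hg hpos q
  obtain ⟨C, hC⟩ := exists_velocity_acceleration_bound hg hpos R
  refine ⟨T, hT, fun t ht => ⟨fun p₀ hp₀ => (normalExp_eq hg hpos (h p₀ hp₀).1 ht).1,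
    (hc t ht).congr fun p₀ hp₀ => (normalExp_eq hg hpos (h p₀ hp₀).1 ht).2⟩, fun φ hφ => ?_⟩
  have hφ1 : ContDiff ℝ ∞ (fderiv ℝ φ) := hφ.fderiv_right (by simp)
  have hφ2 : ContDiff ℝ ∞ (fderiv ℝ (fderiv ℝ φ)) := hφ1.fderiv_right (by simp)
  obtain ⟨B₁, hB₁⟩ := (isCompact_closedBall (0 : Coord 3) R).exists_bound_of_continuousOn
    hφ1.continuous.continuousOn
  obtain ⟨B₂, hB₂⟩ := (isCompact_closedBall (0 : Coord 3) R).exists_bound_of_continuousOn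
    (f := fderiv ℝ (fderiv ℝ φ)) hφ2.continuous.continuousOn
  refine ⟨B₂ * C * C + B₁ * C, fun p₀ hp₀ => ?_⟩
  obtain ⟨htraj, hb⟩ := h p₀ hp₀
  have hx := ((isHamiltonTrajectory_iff hg hpos _ _ _ _ _).1 htraj)
  have h₁ : ∀ r ∈ Set.Icc 0 T, HasDerivWithinAt (fun t => φ (x p₀ t))
      (fderiv ℝ φ (x p₀ r) (velocity g (x p₀ r) (p p₀ r))) (Set.Icc 0 T) r := fun r hr =>
    (differentiable_of_contDiff_top hφ _).hasFDerivAt.comp_hasDerivWithinAt r (hx.2.2 r hr).1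
  have h₂ : ∀ r ∈ Set.Icc 0 T, HasDerivWithinAt
      (fun r => fderiv ℝ φ (x p₀ r) (velocity g (x p₀ r) (p p₀ r)))
      (secondVariation g φ (x p₀ r) (p p₀ r)) (Set.Icc 0 T) r := fun r hr =>
    ((differentiable_of_contDiff_top hφ1 _).hasFDerivAt.comp_hasDerivWithinAt r
      (hx.2.2 r hr).1).clm_apply (hasDerivWithinAt_velocity hg hpos htraj hr (hb r hr).2.2)
  have hbound : ∀ r ∈ Set.Icc 0 T, |secondVariation g φ (x p₀ r) (p p₀ r)|
      ≤ (B₂ * C * C + B₁ * C) * (1 + |p₀ 3|) := by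
    intro r hr
    obtain ⟨hR, h3, hu⟩ := hb r hr
    obtain ⟨hv, ha⟩ := hC _ _ hR hu
    rw [h3] at ha
    have n1 := hB₁ _ (mem_closedBall_zero_iff.2 hR)
    have n2 := hB₂ _ (mem_closedBall_zero_iff.2 hR)
    have hC0 := (norm_nonneg _).trans hv
    have hB20 := (norm_nonneg (fderiv ℝ (fderiv ℝ φ) (x p₀ r))).trans n2
    have hB10 := (norm_nonneg (fderiv ℝ φ (x p₀ r))).trans n1
    have e1 := ContinuousLinearMap.le_opNorm₂ (fderiv ℝ (fderiv ℝ φ) (x p₀ r))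
      (velocity g (x p₀ r) (p p₀ r)) (velocity g (x p₀ r) (p p₀ r))
    have e2 := ContinuousLinearMap.le_opNorm (fderiv ℝ φ (x p₀ r))
      (acceleration g (x p₀ r) (p p₀ r))
    calc |secondVariation g φ (x p₀ r) (p p₀ r)| ≤ _ := abs_add_le _ _
      _ ≤ B₂ * C * C + B₁ * (C * (1 + |p₀ 3|)) := by
        refine add_le_add (e1.trans ?_) (e2.trans ?_) <;> gcongr
      _ ≤ _ := by
        have : 0 ≤ B₂ * C * C * |p₀ 3| := by positivity
        linarith
  have hx0 : x p₀ 0 = q := hx.1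
  have hp0 : p p₀ 0 = p₀ := hx.2.1
  have h0 : (0 : ℝ) ∈ Set.Icc 0 T := Set.left_mem_Icc.2 hT.le
  constructor
  · intro t ht
    have := abs_taylor_le h₁ h₂ hbound ht
    rw [(normalExp_eq hg hpos htraj ht).2]
    simpa only [hx0, hp0] using this
  · have := tendsto_taylor hT h₁ (h₂ 0 h0)
    simp only [hx0, hp0] at this
    refine this.congr' ?_
    filter_upwards [Ioc_mem_nhdsGT hT] with t ht
    rw [(normalExp_eq hg hpos htraj (Set.Ioc_subset_Icc_self ht)).2]

/-! ### Complements and adapted measures -/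

/-- A complement has a global continuous generator, normalised by `contact`. -/
theorem exists_generator_of_isComplement (hg : ContDiff ℝ ∞ g) (hpos : ∀ z, 0 < g z)
    {V : Coord 3 → Submodule ℝ (Coord 3)} (hV : (sr g hg hpos).IsComplement V) :
    ∃ e : Coord 3 → Coord 3, Continuous e ∧
      ∀ q, contact q (e q) = 1 ∧ V q = Submodule.span ℝ {e q} := by
  have hne : ∀ q v, V q = Submodule.span ℝ {v} → contact q v ≠ 0 := by
    intro q v hv h0
    have hD := (mem_distribution_iff hg hpos q v).2 h0
    -- If the generator were horizontal, `V q` would lie in `D`, and `D` would be the whole tangent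
    -- space; but `∂w` is not horizontal.
    have hle : V q ≤ (sr g hg hpos).distribution q := by
      rw [hv, Submodule.span_singleton_le_iff_mem]; exact hD
    have htop := (hV.1 q).sup_eq_top
    rw [sup_eq_left.2 hle] at htop
    have h3 : (Pi.single 3 1 : Coord 3) ∈ (sr g hg hpos).distribution q := by
      rw [htop]; trivial
    rw [mem_distribution_iff] at h3
    simp [contact] at h3
  have hex : ∀ q, ∃ e, contact q e = 1 ∧ V q = Submodule.span ℝ {e} := by
    intro q
    obtain ⟨U, -, hqU, X₀, -, hX⟩ := hV.2 q
    have h0 := hne q _ (hX q hqU)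
    refine ⟨(contact q (X₀ q))⁻¹ • X₀ q, by rw [contact_smul, inv_mul_cancel₀ h0], ?_⟩
    rw [hX q hqU, Submodule.span_singleton_smul_eq (isUnit_iff_ne_zero.2 (inv_ne_zero h0))]
  choose e he using hex
  refine ⟨e, continuous_iff_continuousAt.2 fun q => ?_, he⟩
  obtain ⟨U, hU, hqU, X₀, hX₀, hX⟩ := hV.2 q
  have hc : ContinuousAt X₀ q := hX₀.continuousOn.continuousAt (hU.mem_nhds hqU)
  have hci : ∀ i, ContinuousAt (fun q => X₀ q i) q := fun i => (continuous_apply i).continuousAt.comp hc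
  have hcq : ∀ i : Fin 4, ContinuousAt (fun q : Coord 3 => q i) q := fun i =>
    (continuous_apply i).continuousAt
  have hcont : ContinuousAt (fun q => contact q (X₀ q)) q :=
    ((hci 3).sub (((hcq 1).div_const 2).mul (hci 0))).add (((hcq 0).div_const 2).mul (hci 1))
  have h : ContinuousAt (fun q => (contact q (X₀ q))⁻¹ • X₀ q) q :=
    (hcont.inv₀ (hne q _ (hX q hqU))).smul hc
  refine h.congr ?_
  filter_upwards [hU.mem_nhds hqU] with q' hq'
  have hmem : e q' ∈ Submodule.span ℝ {X₀ q'} := by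
    rw [← hX q' hq', (he q').2]; exact Submodule.mem_span_singleton_self _
  obtain ⟨c, hc⟩ := Submodule.mem_span_singleton.1 hmem
  have h1 := (he q').1
  rw [← hc, contact_smul] at h1
  rw [← hc, eq_inv_of_mul_eq_one_left h1]

theorem dotProduct_eq (q p v : Coord 3) :
    p ⬝ᵥ v = momX q p * v 0 + momY q p * v 1 + p 2 * v 2 + p 3 * contact q v := by
  simp [dotProduct, Fin.sum_univ_four, momX, momY, contact]
  ring

/-- The covector that vanishes on `e` and has momenta `√g u`. -/
noncomputable def lift (g : ℝ → ℝ) (e : Coord 3 → Coord 3) (q : Coord 3)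
    (u : EuclideanSpace ℝ (Fin 3)) : Coord 3 :=
  ![√(g (q 2)) * u 0 + q 1 / 2 * (√(g (q 2)) * (u 0 * e q 0 + u 1 * e q 1 + u 2 * e q 2)),
    √(g (q 2)) * u 1 - q 0 / 2 * (√(g (q 2)) * (u 0 * e q 0 + u 1 * e q 1 + u 2 * e q 2)),
    √(g (q 2)) * u 2, -(√(g (q 2)) * (u 0 * e q 0 + u 1 * e q 1 + u 2 * e q 2))]

theorem momenta_lift (e : Coord 3 → Coord 3) (q : Coord 3) (u : EuclideanSpace ℝ (Fin 3)) :
    momenta q (lift g e q u) = √(g (q 2)) • u.ofLp := by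
  ext j
  fin_cases j <;> simp [momenta, momX, momY, lift]

theorem lift_dotProduct {e : Coord 3 → Coord 3} {q : Coord 3} (he : contact q (e q) = 1)
    (u : EuclideanSpace ℝ (Fin 3)) : lift g e q u ⬝ᵥ e q = 0 := by
  have h := momenta_lift (g := g) e q u
  have h0 : momX q (lift g e q u) = √(g (q 2)) * u 0 := congrFun h 0
  have h1 : momY q (lift g e q u) = √(g (q 2)) * u 1 := congrFun h 1
  rw [dotProduct_eq q, h0, h1, he]
  simp [lift]
  ring

theorem dotProduct_frame_eq_iff (hpos : ∀ z, 0 < g z) (q p : Coord 3)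
    (u : EuclideanSpace ℝ (Fin 3)) :
    (∀ i, p ⬝ᵥ frame g i q = u i) ↔ momenta q p = √(g (q 2)) • u.ofLp := by
  have hs : √(g (q 2)) ≠ 0 := (Real.sqrt_pos.2 (hpos _)).ne'
  rw [funext_iff]
  refine forall_congr' fun i => ?_
  rw [dotProduct_frame]
  change 1 / √(g (q 2)) * momenta q p i = u i ↔ momenta q p i = √(g (q 2)) * u i
  rw [one_div, inv_mul_eq_iff_eq_mul₀ hs]

theorem eq_of_momenta_eq {q p p' : Coord 3} (h : momenta q p = momenta q p') (h3 : p 3 = p' 3) :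
    p = p' := by
  have h0 : momX q p = momX q p' := congrFun h 0
  have h1 : momY q p = momY q p' := congrFun h 1
  have h2 : p 2 = p' 2 := congrFun h 2
  simp only [momX, momY, h3] at h0 h1
  ext j
  fin_cases j
  · simpa using h0
  · simpa using h1
  · exact h2
  · exact h3

theorem isHorizontalLift_lift (hg : ContDiff ℝ ∞ g) (hpos : ∀ z, 0 < g z)
    {V : Coord 3 → Submodule ℝ (Coord 3)} {e : Coord 3 → Coord 3}
    (he : ∀ q, contact q (e q) = 1 ∧ V q = Submodule.span ℝ {e q}) :
    (sr g hg hpos).IsHorizontalLift V (lift g e) := by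
  intro q u
  constructor
  · intro v hv
    rw [(he q).2] at hv
    obtain ⟨c, rfl⟩ := Submodule.mem_span_singleton.1 hv
    rw [dotProduct_smul, lift_dotProduct (he q).1, smul_zero]
  · exact (dotProduct_frame_eq_iff hpos q _ u).2 (momenta_lift e q u)

/-- The frame values fix the three momenta, and vanishing on `e` fixes the vertical component since
`contact q (e q) = 1`. The lift in an adapted family can thus be taken explicit. -/
theorem eq_lift_of_isHorizontalLift (hg : ContDiff ℝ ∞ g) (hpos : ∀ z, 0 < g z)
    {V : Coord 3 → Submodule ℝ (Coord 3)} {e : Coord 3 → Coord 3}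
    (he : ∀ q, contact q (e q) = 1 ∧ V q = Submodule.span ℝ {e q})
    {Φ : Coord 3 → EuclideanSpace ℝ (Fin 3) → Coord 3}
    (hΦ : (sr g hg hpos).IsHorizontalLift V Φ) : Φ = lift g e := by
  ext1 q
  ext1 u
  have hm := (dotProduct_frame_eq_iff hpos q _ u).1 (hΦ q u).2
  have hm' : momenta q (Φ q u) = momenta q (lift g e q u) := by rw [hm, momenta_lift]
  have h0 : momX q (Φ q u) = momX q (lift g e q u) := congrFun hm' 0
  have h1 : momY q (Φ q u) = momY q (lift g e q u) := congrFun hm' 1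
  have h2 : Φ q u 2 = lift g e q u 2 := congrFun hm' 2
  refine eq_of_momenta_eq hm' ?_
  have a := (hΦ q u).1 (e q) (by rw [(he q).2]; exact Submodule.mem_span_singleton_self _)
  have b := lift_dotProduct (g := g) (he q).1 u
  rw [dotProduct_eq q, (he q).1, h0, h1, h2] at a
  rw [dotProduct_eq q, (he q).1] at b
  linarith

theorem continuous_lift (hg : ContDiff ℝ ∞ g) {e : Coord 3 → Coord 3} (he : Continuous e) :
    Continuous fun y : Coord 3 × EuclideanSpace ℝ (Fin 3) => lift g e y.1 y.2 := by
  have hs : Continuous fun y : Coord 3 × EuclideanSpace ℝ (Fin 3) => √(g (y.1 2)) :=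
    (hg.continuous.comp (by fun_prop)).sqrt
  have hei : ∀ i, Continuous fun y : Coord 3 × EuclideanSpace ℝ (Fin 3) => e y.1 i := fun i =>
    (continuous_apply i).comp (he.comp continuous_fst)
  have h0 := hei 0
  have h1 := hei 1
  have h2 := hei 2
  refine continuous_pi fun j => ?_
  fin_cases j <;> simp [lift] <;> fun_prop

/-- The Dirac mass at `0` on `D_q^⊥` serves as vertical factor. Continuity of the second moments is
then continuity of an integral over the compact sphere with a jointly continuous integrand. -/
theorem exists_isAdapted (hg : ContDiff ℝ ∞ g) (hpos : ∀ z, 0 < g z)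
    {V : Coord 3 → Submodule ℝ (Coord 3)} (hV : (sr g hg hpos).IsComplement V) :
    ∃ μ, (sr g hg hpos).IsAdapted V μ := by
  obtain ⟨e, hec, he⟩ := exists_generator_of_isComplement hg hpos hV
  have hl := continuous_lift hg hec
  have hlq : ∀ q, Continuous (lift g e q) := fun q => hl.comp (by fun_prop :
    Continuous fun u : EuclideanSpace ℝ (Fin 3) => (q, u))
  refine ⟨fun q => ((uniformSphere 3).prod (Measure.dirac 0)).map
    (fun y => lift g e q y.1.1 + y.2), ⟨lift g e, fun _ => Measure.dirac 0,
      isHorizontalLift_lift hg hpos he, fun q => ⟨inferInstance, ?_, ?_, rfl⟩⟩, ?_⟩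
  · rw [ae_dirac_eq]
    simp
  · intro w
    refine (memLp_const (0 : ℝ)).ae_eq ?_
    rw [EventuallyEq, ae_dirac_eq]
    simp
  · intro f hf hlin
    have hint : ∀ q, ∫ p, f q p ^ 2 ∂(((uniformSphere 3).prod (Measure.dirac 0)).map
        (fun y => lift g e q y.1.1 + y.2)) = ∫ u, f q (lift g e q u.1) ^ 2 ∂(uniformSphere 3) := by
      intro q
      have hfq : Continuous fun p => f q p ^ 2 :=
        (hf.comp (by fun_prop : Continuous fun p : Coord 3 => (q, p))).pow 2
      have hm : Measurable fun y : Metric.sphere (0 : EuclideanSpace ℝ (Fin 3)) 1 × Coord 3 =>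
          lift g e q y.1.1 + y.2 := by
        have := hlq q
        exact (by fun_prop : Continuous _).measurable
      have hm' : AEStronglyMeasurable (fun y : Metric.sphere (0 : EuclideanSpace ℝ (Fin 3)) 1 ×
          Coord 3 => f q (lift g e q y.1.1 + y.2) ^ 2)
          ((uniformSphere 3).map fun u => (u, (0 : Coord 3))) :=
        (hfq.measurable.comp hm).aestronglyMeasurable
      rw [integral_map hm.aemeasurable hfq.aestronglyMeasurable, Measure.prod_dirac,
        integral_map (by fun_prop) hm']
      simp
    simp only [hint]
    have hcont : Continuous (Function.uncurry fun (q : Coord 3)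
        (u : Metric.sphere (0 : EuclideanSpace ℝ (Fin 3)) 1) => f q (lift g e q u.1) ^ 2) := by
      have h1 : Continuous fun y : Coord 3 × Metric.sphere (0 : EuclideanSpace ℝ (Fin 3)) 1 =>
          lift g e y.1 y.2.1 := hl.comp (by fun_prop :
            Continuous fun y : Coord 3 × Metric.sphere (0 : EuclideanSpace ℝ (Fin 3)) 1 =>
              (y.1, y.2.1))
      exact (hf.comp (continuous_fst.prodMk h1)).pow 2
    have := continuous_parametric_integral_of_continuous (μ := uniformSphere 3) hcont isCompact_univ
    simpa using this

/-! ### The microscopic Laplacian -/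

theorem horizontalVec_neg (g : ℝ → ℝ) (q : Coord 3) (u : Fin 3 → ℝ) :
    horizontalVec g q (-u) = -horizontalVec g q u := by
  ext j
  fin_cases j <;> (simp [horizontalVec]; try ring)

theorem magneticVec_neg (g : ℝ → ℝ) (q : Coord 3) (u : Fin 3 → ℝ) :
    magneticVec g q (-u) = -magneticVec g q u := by
  ext j
  fin_cases j <;> (simp [magneticVec]; try ring)

theorem momenta_add (q p p' : Coord 3) : momenta q (p + p') = momenta q p + momenta q p' := by
  ext j
  fin_cases j <;> simp [momenta, momX, momY] <;> ring

theorem momenta_eq_zero_of_annihilates (hg : ContDiff ℝ ∞ g) (hpos : ∀ z, 0 < g z)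
    {q p : Coord 3} (hp : ∀ v ∈ (sr g hg hpos).distribution q, p ⬝ᵥ v = 0) : momenta q p = 0 := by
  have h : ∀ i, p ⬝ᵥ frame g i q = (0 : EuclideanSpace ℝ (Fin 3)) i := fun i => hp _ (by
    rw [mem_distribution_iff, frame_eq, contact_smul, contact_flatFrame, mul_zero])
  simpa using (dotProduct_frame_eq_iff hpos q p 0).1 h

theorem mem_unitCovectors_of_momenta (hg : ContDiff ℝ ∞ g) (hpos : ∀ z, 0 < g z) {q p : Coord 3}
    {u : EuclideanSpace ℝ (Fin 3)} (hu : ‖u‖ = 1) (h : momenta q p = √(g (q 2)) • u.ofLp) :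
    p ∈ (sr g hg hpos).unitCovectors q := by
  rw [mem_unitCovectors_iff]
  have h0 : momX q p = √(g (q 2)) * u 0 := congrFun h 0
  have h1 : momY q p = √(g (q 2)) * u 1 := congrFun h 1
  have h2 : p 2 = √(g (q 2)) * u 2 := congrFun h 2
  have hn := EuclideanSpace.norm_sq_eq u
  rw [hu, Fin.sum_univ_three] at hn
  simp only [Real.norm_eq_abs, sq_abs] at hn
  rw [h0, h1, h2, mul_pow, mul_pow, mul_pow, Real.sq_sqrt (hpos _).le]
  linear_combination -(g (q 2)) * hn

theorem measurableSet_unitCovectors (hg : ContDiff ℝ ∞ g) (hpos : ∀ z, 0 < g z) (q : Coord 3) :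
    MeasurableSet ((sr g hg hpos).unitCovectors q) := by
  have e : (sr g hg hpos).unitCovectors q =
      {p | momX q p ^ 2 + momY q p ^ 2 + p 2 ^ 2 = g (q 2)} := by
    ext p; exact mem_unitCovectors_iff hg hpos q p
  rw [e]
  exact (isClosed_eq (by unfold momX momY; fun_prop) continuous_const).measurableSet

theorem continuous_velocity (hg : ContDiff ℝ ∞ g) (hpos : ∀ z, 0 < g z) (q : Coord 3) :
    Continuous (velocity g q) :=
  (continuous_horizontalVec hg hpos).comp (continuous_const.prodMk (continuous_momenta q))

theorem continuous_secondVariation (hg : ContDiff ℝ ∞ g) (hpos : ∀ z, 0 < g z) (φ : Coord 3 → ℝ)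
    (q : Coord 3) : Continuous (secondVariation g φ q) := by
  have h1 := continuous_velocity hg hpos q
  have h2 : Continuous fun p => magneticVec g q (momenta q p) :=
    (continuous_magneticVec hg hpos).comp (continuous_const.prodMk (continuous_momenta q))
  have h3 : Continuous fun p => conformalVec g q (momenta q p) :=
    (continuous_conformalVec hg hpos).comp (continuous_const.prodMk (continuous_momenta q))
  have h4 : Continuous (acceleration g q) := ((continuous_apply (3 : Fin 4)).smul h2).add h3
  exact (((fderiv ℝ (fderiv ℝ φ) q).continuous.comp h1).clm_apply h1).add
    ((fderiv ℝ φ q).continuous.comp h4)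

/-- A covector annihilating `D` has zero momenta, so adding it changes only the explicit factor `p
3` in front of the magnetic term. -/
theorem secondVariation_lift_add (hg : ContDiff ℝ ∞ g) (hpos : ∀ z, 0 < g z) (φ : Coord 3 → ℝ)
    (e : Coord 3 → Coord 3) {q v : Coord 3}
    (hv : ∀ w ∈ (sr g hg hpos).distribution q, v ⬝ᵥ w = 0) (u : EuclideanSpace ℝ (Fin 3)) :
    secondVariation g φ q (lift g e q u + v) = secondVariation g φ q (lift g e q u)
      + fderiv ℝ φ q (magneticVec g q (√(g (q 2)) • u.ofLp)) * v 3 := by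
  have hm : momenta q (lift g e q u + v) = √(g (q 2)) • u.ofLp := by
    rw [momenta_add, momenta_eq_zero_of_annihilates hg hpos hv, add_zero, momenta_lift]
  simp only [secondVariation, acceleration, velocity_eq, hm, momenta_lift, map_add, map_smul,
    Pi.add_apply, smul_eq_mul]
  ring

/-- The properties of adapted measures that determine the microscopic Laplacian. -/
structure IsSplitMeasure (g : ℝ → ℝ) (hg : ContDiff ℝ ∞ g) (hpos : ∀ z, 0 < g z)
    (e : Coord 3 → Coord 3) (q : Coord 3) (μ : Measure (Coord 3)) : Prop where
  isProbabilityMeasure : IsProbabilityMeasure μ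
  ae_mem : ∀ᵐ p ∂μ, p ∈ (sr g hg hpos).unitCovectors q
  integrable_vertical : Integrable (fun p : Coord 3 => p 3) μ
  integral_velocity : ∀ A : Coord 3 →L[ℝ] ℝ, ∫ p, A (velocity g q p) ∂μ = 0
  integral_secondVariation : ∀ φ : Coord 3 → ℝ, ∫ p, secondVariation g φ q p ∂μ
    = ∫ u, secondVariation g φ q (lift g e q u.1) ∂(uniformSphere 3)

/-- This is where the product form of the measure matters. Velocity and magnetic term are odd in the
spherical variable, so their means vanish, the latter even after multiplication by the independent
vertical component. Square integrability enters only through integrability of `p 3`. -/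
theorem isSplitMeasure_of_isAdapted (hg : ContDiff ℝ ∞ g) (hpos : ∀ z, 0 < g z)
    {V : Coord 3 → Submodule ℝ (Coord 3)} {e : Coord 3 → Coord 3} (hec : Continuous e)
    (he : ∀ q, contact q (e q) = 1 ∧ V q = Submodule.span ℝ {e q})
    {μ : Coord 3 → Measure (Coord 3)} (hμ : (sr g hg hpos).IsAdapted V μ) (q : Coord 3) :
    IsSplitMeasure g hg hpos e q (μ q) := by
  obtain ⟨⟨Φ, ν, hΦ, hν⟩, -⟩ := hμ
  obtain rfl := eq_lift_of_isHorizontalLift hg hpos he hΦ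
  obtain ⟨hprob, hann, hmem, hmap⟩ := hν q
  let S := Metric.sphere (0 : EuclideanSpace ℝ (Fin 3)) 1
  have hlq : Continuous (lift g e q) := (continuous_lift hg hec).comp (by fun_prop :
    Continuous fun u : EuclideanSpace ℝ (Fin 3) => (q, u))
  have hG : Continuous fun y : S × Coord 3 => lift g e q y.1.1 + y.2 := by fun_prop
  have hGm := hG.measurable.aemeasurable (μ := (uniformSphere 3).prod (ν q))
  have hann' : ∀ᵐ y ∂((uniformSphere 3).prod (ν q)),
      ∀ v ∈ (sr g hg hpos).distribution q, y.2 ⬝ᵥ v = 0 :=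
    Measure.quasiMeasurePreserving_snd.ae hann
  have hmom : ∀ᵐ y : S × Coord 3 ∂((uniformSphere 3).prod (ν q)),
      momenta q (lift g e q y.1.1 + y.2) = √(g (q 2)) • y.1.1.ofLp := by
    filter_upwards [hann'] with y hy
    rw [momenta_add, momenta_eq_zero_of_annihilates hg hpos hy, add_zero, momenta_lift]
  have hint3 : Integrable (fun p : Coord 3 => p 3) (ν q) := by
    have := (hmem (Pi.single 3 1)).integrable one_le_two
    simpa using this
  rw [hmap]
  refine ⟨?_, ?_, ?_, fun A => ?_, fun φ => ?_⟩
  · exact Measure.isProbabilityMeasure_map hGm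
  · refine (ae_map_iff (p := (· ∈ (sr g hg hpos).unitCovectors q)) hGm
      (measurableSet_unitCovectors hg hpos q)).2 ?_
    filter_upwards [hmom] with y hy
    exact mem_unitCovectors_of_momenta hg hpos (by simp) hy
  · rw [integrable_map_measure (continuous_apply (3 : Fin 4)).aestronglyMeasurable hGm]
    have h1 : Integrable (fun u : S => lift g e q u.1 3) (uniformSphere 3) :=
      Continuous.integrable_uniformSphere (by fun_prop)
    exact (h1.comp_fst (ν q)).add (hint3.comp_snd (uniformSphere 3))
  · have hAv : Continuous fun p => A (velocity g q p) :=
      A.continuous.comp (continuous_velocity hg hpos q)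
    rw [integral_map hGm hAv.aestronglyMeasurable]
    have h1 : ∫ y : S × Coord 3, A (velocity g q (lift g e q y.1.1 + y.2))
        ∂((uniformSphere 3).prod (ν q)) = ∫ y : S × Coord 3,
          A (horizontalVec g q (√(g (q 2)) • y.1.1.ofLp)) ∂((uniformSphere 3).prod (ν q)) := by
      refine integral_congr_ae ?_
      filter_upwards [hmom] with y hy
      rw [velocity_eq, hy]
    rw [h1, integral_fun_fst (f := fun u : S => A (horizontalVec g q (√(g (q 2)) • u.1.ofLp))),
      integral_uniformSphere_of_odd (fun u => A (horizontalVec g q (√(g (q 2)) • u.ofLp)))]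
    · simp
    · intro u
      rw [WithLp.ofLp_neg, smul_neg, horizontalVec_neg, map_neg]
  · rw [integral_map hGm (continuous_secondVariation hg hpos φ q).aestronglyMeasurable]
    have h1 : ∫ y : S × Coord 3, secondVariation g φ q (lift g e q y.1.1 + y.2)
        ∂((uniformSphere 3).prod (ν q)) = ∫ y : S × Coord 3,
          (secondVariation g φ q (lift g e q y.1.1)
            + fderiv ℝ φ q (magneticVec g q (√(g (q 2)) • y.1.1.ofLp)) * y.2 3)
          ∂((uniformSphere 3).prod (ν q)) := by
      refine integral_congr_ae ?_
      filter_upwards [hann'] with y hy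
      exact secondVariation_lift_add hg hpos φ e hy y.1.1
    have c1 : Continuous fun u : S => secondVariation g φ q (lift g e q u.1) :=
      (continuous_secondVariation hg hpos φ q).comp (hlq.comp continuous_subtype_val)
    have c2 : Continuous fun u : S =>
        fderiv ℝ φ q (magneticVec g q (√(g (q 2)) • u.1.ofLp)) :=
      (fderiv ℝ φ q).continuous.comp ((continuous_magneticVec hg hpos).comp
        (continuous_const.prodMk (by fun_prop :
          Continuous fun u : S => √(g (q 2)) • u.1.ofLp)))
    have i1 := c1.integrable_uniformSphere
    have i2 := c2.integrable_uniformSphere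
    rw [h1, integral_add (i1.comp_fst (ν q)) (i2.mul_prod hint3),
      integral_fun_fst (f := fun u : S => secondVariation g φ q (lift g e q u.1)),
      integral_prod_mul (fun u : S => fderiv ℝ φ q (magneticVec g q (√(g (q 2)) • u.1.ofLp)))
        (fun p : Coord 3 => p 3),
      integral_uniformSphere_of_odd (fun u =>
        fderiv ℝ φ q (magneticVec g q (√(g (q 2)) • u.ofLp)))]
    · simp [S]
    · intro u
      rw [WithLp.ofLp_neg, smul_neg, magneticVec_neg, map_neg]

/-- The microscopic Laplacian of the complement spanned by `e`. -/
noncomputable def microLaplacian (g : ℝ → ℝ) (e : Coord 3 → Coord 3) (φ : SmoothFun 3)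
    (q : Coord 3) : ℝ :=
  3 * ∫ u, secondVariation g φ.1 q (lift g e q u.1) ∂(uniformSphere 3)

theorem isMicroLaplacian_microLaplacian (hg : ContDiff ℝ ∞ g) (hpos : ∀ z, 0 < g z)
    {e : Coord 3 → Coord 3} {μ : Coord 3 → Measure (Coord 3)}
    (hμ : ∀ q, IsSplitMeasure g hg hpos e q (μ q)) :
    (sr g hg hpos).IsMicroLaplacian μ (microLaplacian g e) := by
  intro q
  obtain ⟨hprob, hae, hi3, hvel, hsec⟩ := hμ q
  obtain ⟨T, hT, hgeo, hexp⟩ := exists_normalExp_expansion hg hpos q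
  have hTmem : Set.Ioc 0 T ∈ 𝓝[>] (0 : ℝ) := Ioc_mem_nhdsGT hT
  refine ⟨by filter_upwards [hTmem] with t ht using (hgeo t (Set.Ioc_subset_Icc_self ht)).1,
    fun φ => ?_⟩
  obtain ⟨C, hC⟩ := hexp φ.1 φ.2
  -- The exponential map is known to be continuous only on the cylinder; since the measure is
  -- carried by it, this suffices for measurability.
  have hrestrict : (μ q).restrict ((sr g hg hpos).unitCovectors q) = μ q :=
    Measure.restrict_eq_self_of_ae_mem hae
  have hmeas : ∀ t ∈ Set.Ioc 0 T,
      AEStronglyMeasurable (fun p => φ.1 ((sr g hg hpos).normalExp q t p)) (μ q) := by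
    intro t ht
    have := (φ.2.continuous.comp_continuousOn
      (hgeo t (Set.Ioc_subset_Icc_self ht)).2).aestronglyMeasurable (μ := μ q)
        (measurableSet_unitCovectors hg hpos q)
    rwa [hrestrict] at this
  have hcv : Continuous fun p => fderiv ℝ φ.1 q (velocity g q p) :=
    (fderiv ℝ φ.1 q).continuous.comp (continuous_velocity hg hpos q)
  have hiv : Integrable (fun p => fderiv ℝ φ.1 q (velocity g q p)) (μ q) := by
    obtain ⟨B, hB⟩ := exists_velocity_acceleration_bound hg hpos ‖q‖
    refine Integrable.of_bound hcv.aestronglyMeasurable (‖fderiv ℝ φ.1 q‖ * B) ?_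
    filter_upwards [hae] with p hp
    exact (ContinuousLinearMap.le_opNorm _ _).trans
      (mul_le_mul_of_nonneg_left (hB q p le_rfl hp).1 (norm_nonneg _))
  set r : ℝ → Coord 3 → ℝ := fun t p => φ.1 ((sr g hg hpos).normalExp q t p) - φ.1 q
    - t * fderiv ℝ φ.1 q (velocity g q p) with hr
  have hrm : ∀ t ∈ Set.Ioc 0 T, AEStronglyMeasurable (r t) (μ q) := fun t ht =>
    ((hmeas t ht).sub aestronglyMeasurable_const).sub
      (hcv.aestronglyMeasurable.const_mul t)
  have hib : Integrable (fun p : Coord 3 => C * (1 + |p 3|)) (μ q) :=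
    ((integrable_const 1).add hi3.abs).const_mul C
  have hir : ∀ t ∈ Set.Ioc 0 T, Integrable (r t) (μ q) := by
    intro t ht
    refine (hib.mul_const (t ^ 2)).mono' (hrm t ht) ?_
    filter_upwards [hae] with p hp
    exact (hC p hp).1 t (Set.Ioc_subset_Icc_self ht)
  have hdiff : ∀ t, (fun p => φ.1 ((sr g hg hpos).normalExp q t p) - φ.1 q)
      = fun p => r t p + t * fderiv ℝ φ.1 q (velocity g q p) := by
    intro t; ext p; simp [hr]
  refine ⟨?_, ?_⟩
  · filter_upwards [hTmem] with t ht
    rw [hdiff]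
    exact (hir t ht).add (hiv.const_mul t)
  · have hlim : Tendsto (fun t => ∫ p, r t p / t ^ 2 ∂(μ q)) (𝓝[>] 0)
        (𝓝 (∫ p, secondVariation g φ.1 q p / 2 ∂(μ q))) := by
      refine tendsto_integral_filter_of_dominated_convergence (fun p => C * (1 + |p 3|)) ?_ ?_ hib
        ?_
      · filter_upwards [hTmem] with t ht
        exact (hrm t ht).mul_const _
      · filter_upwards [hTmem] with t ht
        filter_upwards [hae] with p hp
        have h2 : 0 < t ^ 2 := pow_pos ht.1 2
        rw [Real.norm_eq_abs, abs_div, abs_of_pos h2, div_le_iff₀ h2]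
        exact (hC p hp).1 t (Set.Ioc_subset_Icc_self ht)
      · filter_upwards [hae] with p hp
        exact (hC p hp).2
    -- The factor is `2k = 6`; half of it, `3`, is the constant in `microLaplacian`.
    have h6 := hlim.const_mul 6
    have hval : 6 * ∫ p, secondVariation g φ.1 q p / 2 ∂(μ q) = microLaplacian g e φ q := by
      rw [integral_div, hsec, microLaplacian]; ring
    rw [hval] at h6
    refine h6.congr' ?_
    filter_upwards [hTmem] with t ht
    rw [hdiff, integral_add (hir t ht) (hiv.const_mul t), integral_const_mul, hvel, mul_zero,
      add_zero, integral_div]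
    push_cast
    ring

/-! ### Comparison of the two Laplacians on the coordinate `z` -/

/-- The Hessian of `z` vanishes and the magnetic term has no `z`-component, so `e` drops out. The
constant is `3 (1/2 - 1/3) = 1/2`. -/
theorem microLaplacian_coordZ (hpos : ∀ z, 0 < g z) (e : Coord 3 → Coord 3)
    (q : Coord 3) :
    microLaplacian g e coordZ q = 1 / 2 * deriv g (q 2) / g (q 2) ^ 2 := by
  have hp := hpos (q 2)
  have h2 : fderiv ℝ (fderiv ℝ coordZ.1) q = 0 := by
    have : fderiv ℝ coordZ.1 = fun _ =>
        ContinuousLinearMap.proj (R := ℝ) (φ := fun _ : Fin 4 => ℝ) 2 := by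
      ext1 q; exact fderiv_coordZ q
    rw [this]
    exact fderiv_const_apply _
  have hs : √(g (q 2)) ^ 2 = g (q 2) := Real.sq_sqrt hp.le
  have hF : ∀ u : EuclideanSpace ℝ (Fin 3), secondVariation g coordZ.1 q (lift g e q u)
      = deriv g (q 2) / 2 / g (q 2) ^ 2 - deriv g (q 2) / g (q 2) ^ 2 * u 2 ^ 2 := by
    intro u
    rw [secondVariation, h2, fderiv_coordZ, acceleration, momenta_lift]
    simp [magneticVec, conformalVec, horizontalVec]
    field_simp
    rw [hs]
    ring
  have hc : Continuous fun x : Metric.sphere (0 : EuclideanSpace ℝ (Fin 3)) 1 => x.1 2 ^ 2 := by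
    fun_prop
  rw [microLaplacian]
  simp only [hF]
  rw [integral_sub (integrable_const _) (hc.integrable_uniformSphere.const_mul _),
    integral_const_mul, integral_uniformSphere_coord_sq]
  simp
  ring

theorem exists_deriv_ne_zero (hg : ContDiff ℝ ∞ g) (hmono : StrictMono g ∨ StrictAnti g) :
    ∃ z, deriv g z ≠ 0 := by
  by_contra! h
  have := is_const_of_deriv_eq_zero (differentiable_of_contDiff_top hg) h 0 1
  rcases hmono with hm | hm
  · exact (hm zero_lt_one).ne this
  · exact (hm zero_lt_one).ne' this

theorem microLaplacian_ne_macroLaplacian (hg : ContDiff ℝ ∞ g) (hpos : ∀ z, 0 < g z)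
    (hmono : StrictMono g ∨ StrictAnti g) {P : Coord 3 → Coord 3 [⋀^Fin 4]→L[ℝ] ℝ}
    (hP : (sr g hg hpos).IsPoppVolume P) (e : Coord 3 → Coord 3) :
    microLaplacian g e ≠ (sr g hg hpos).macroLaplacian P := by
  intro h
  obtain ⟨z, hz⟩ := exists_deriv_ne_zero hg hmono
  have h1 := congrFun (congrFun h coordZ) (Pi.single 2 z)
  rw [microLaplacian_coordZ hpos, macroLaplacian_coordZ hg hpos hP] at h1
  have hp := hpos z
  simp only [Pi.single_eq_same] at h1
  field_simp at h1
  norm_num at h1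

end QuasiContactExample

theorem mainTheorem5 (g : ℝ → ℝ) (hg : ContDiff ℝ ∞ g) (hpos : ∀ z, 0 < g z)
    (hmono : StrictMono g ∨ StrictAnti g) :
    (QuasiContactExample.sr g hg hpos).IsQuasiContact ∧
    (QuasiContactExample.sr g hg hpos).IsPoppVolume (QuasiContactExample.poppForm g) ∧
    ∀ P : Coord 3 → Coord 3 [⋀^Fin (3 + 1)]→L[ℝ] ℝ,
      (QuasiContactExample.sr g hg hpos).IsPoppVolume P →
      ∀ V : Coord 3 → Submodule ℝ (Coord 3),
        (QuasiContactExample.sr g hg hpos).IsComplement V →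
        (∃ μ, (QuasiContactExample.sr g hg hpos).IsAdapted V μ) ∧
        ∃ L : SmoothFun 3 → Coord 3 → ℝ,
          (∀ μ, (QuasiContactExample.sr g hg hpos).IsAdapted V μ →
            (QuasiContactExample.sr g hg hpos).IsMicroLaplacian μ L) ∧
          L ≠ (QuasiContactExample.sr g hg hpos).macroLaplacian P := by
  refine ⟨QuasiContactExample.isQuasiContact hg hpos,
    QuasiContactExample.isPoppVolume_poppForm hg hpos, fun P hP V hV =>
      ⟨QuasiContactExample.exists_isAdapted hg hpos hV, ?_⟩⟩
  -- The generator depends on `V` alone and is fixed before `μ`, so one operator serves every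
  -- adapted family.
  obtain ⟨e, hec, he⟩ := QuasiContactExample.exists_generator_of_isComplement hg hpos hV
  exact ⟨QuasiContactExample.microLaplacian g e, fun μ hμ =>
    QuasiContactExample.isMicroLaplacian_microLaplacian hg hpos fun q =>
      QuasiContactExample.isSplitMeasure_of_isAdapted hg hpos hec he hμ q,
    QuasiContactExample.microLaplacian_ne_macroLaplacian hg hpos hmono hP e⟩
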